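/- **Setting.** Consider a single-server FIFO queue, initially empty, with i.i.d. service times $S_1,S_2,\dots\ge 0$ distributed as $S$, $\mathbb E[S]=1/\mu$, $\mu>0$. Time is either discrete (all times and random variables are integer-valued; $H$ is Shannon entropy) or continuous (real-valued; $H$ is differential entropy, equal to $-\infty$ for a law without density; in this case $S$ is assumed to have a density and $H(S)>-\infty$). Logarithms are to base two. If packet $i$ arrives at time $a_i\ge 0$, where $a_1\le a_2\le\cdots$, then its departure time is $d_i=\max\{a_i,d_{i-1}\}+S_i$, with $d_0=0$. An $(n,M,T,\varepsilon)$-code without feedback consists of $M$ vectors of arrival times $a_1\le\cdots\le a_n$, one for each message $u\in\{1,\dots,M\}$, and of a decoder $\hat u(d_1,\dots,d_n)$ such that, for equiprobable messages independent of the service times, $\mathbb E[d_n]\le T$ and $\mathbb P(\hat u\ne u)\le\varepsilon$. In a feedback code, $a_i$ may moreover depend causally on the departure times: whether $a_i=t$ may depend on the departures that occur before time $t$, but not on the later ones. For $\lambda>0$, the capacity $C(\lambda)$ at output rate $\lambda$ (respectively the feedback capacity $C_F(\lambda)$) is the supremum of the $R$ such that for every $\gamma>0$ there are $\varepsilon_n\to0$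 and, for all large $n$, an $(n,M_n,n/\lambda,\varepsilon_n)$-code without feedback (respectively with feedback) with $\lambda\,\frac{\log M_n}{n}>R-\gamma$. **Theorem.** Let $0<\lambda<\mu$ and suppose that $$\sup_{X:\ \mathbb E[(X-S_1)^+]\le\frac1\lambda-\frac1\mu} H\big((X-S_1)^++S_2\big)\;<\;\sup_{W\ge 0:\ \mathbb E[W]\le\frac1\lambda-\frac1\mu} H(W+S),$$ where $S_1,S_2$ are independent and distributed as $S$, where $X$ ranges over all real random variables (integer-valued in discrete time) independent of $(S_1,S_2)$, and where $W$ ranges over all nonnegative random variables (integer-valued in discrete time) independent of $S$. Then $$C(\lambda)<C_F(\lambda).$$ -/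

import Mathlib

open MeasureTheory Filter Topology

noncomputable section

/-- The two versions of the timing channel. -/
inductive TimeModel where
  | discrete
  | continuous

namespace TimeModel

/-- The values that a real random variable of the model may take: the integers in discrete time,
all reals in continuous time. -/
def grid : TimeModel → Set ℝ
  | discrete => Set.range (fun k : ℤ => (k : ℝ))
  | continuous => Set.univ

/-- Nonnegative times of the model. -/
def times (m : TimeModel) : Set ℝ := {t | t ∈ m.grid ∧ 0 ≤ t}

/-- Shannon entropy, in bits, of a law carried by the integers. -/
def shannonEntropy (P : Measure ℝ) : EReal :=
  ((∑' k : ℤ, ENNReal.ofReal (-(P.real {(k : ℝ)} * Real.logb 2 (P.real {(k : ℝ)}))) : ENNReal) :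
    EReal)

open Classical in
/-- Differential entropy `-∫ f log₂ f`, in bits, of a law on `ℝ` with density `f`; it is `-∞` for
a law without density. The positive part of `-f log₂ f` is integrable whenever the law
is carried by `[0, ∞)` and has a finite mean, so that no `∞ - ∞` occurs for such laws. -/
def differentialEntropy (P : Measure ℝ) : EReal :=
  if P ≪ volume then
    ((∫⁻ x, ENNReal.ofReal
        (-((P.rnDeriv volume x).toReal * Real.logb 2 (P.rnDeriv volume x).toReal)) : ENNReal) :
      EReal)
    - ((∫⁻ x, ENNReal.ofReal
        ((P.rnDeriv volume x).toReal * Real.logb 2 (P.rnDeriv volume x).toReal) : ENNReal) :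
      EReal)
  else ⊥

/-- The entropy `H` of the model, as a function of the law of the random variable. -/
def entropy : TimeModel → Measure ℝ → EReal
  | discrete => shannonEntropy
  | continuous => differentialEntropy

/-- Supremum of `H((X - S₁)⁺ + S₂)` over all laws `P` of `X` with `E[(X - S₁)⁺] ≤ a`, where
`X`, `S₁`, `S₂` are independent and `S₁`, `S₂` have the law `ν`. -/
def maxEntropyDelayed (m : TimeModel) (ν : Measure ℝ) (a : ℝ) : EReal :=
  ⨆ (P : Measure ℝ) (_ : IsProbabilityMeasure P ∧ (∀ᵐ x ∂P, x ∈ m.grid) ∧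
      ∫⁻ z, ENNReal.ofReal (max (z.1 - z.2) 0) ∂(P.prod ν) ≤ ENNReal.ofReal a),
    m.entropy ((P.prod (ν.prod ν)).map (fun z : ℝ × ℝ × ℝ => max (z.1 - z.2.1) 0 + z.2.2))

/-- Supremum of `H(W + S)` over all laws `P` of `W ≥ 0` with `E[W] ≤ a`, where
`W`, `S` are independent and `S` has the law `ν`. -/
def maxEntropy (m : TimeModel) (ν : Measure ℝ) (a : ℝ) : EReal :=
  ⨆ (P : Measure ℝ) (_ : IsProbabilityMeasure P ∧ (∀ᵐ w ∂P, w ∈ m.times) ∧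
      ∫⁻ w, ENNReal.ofReal w ∂P ≤ ENNReal.ofReal a),
    m.entropy ((P.prod ν).map (fun z : ℝ × ℝ => z.1 + z.2))

end TimeModel

namespace Queue

/-- `previous d i` is the term of `d` before the `i`-th one (packets are numbered from `0`), and
`0` if there is none. So `previous d n` is the last of the first `n` departures. -/
def previous (d : ℕ → ℝ) : ℕ → ℝ
  | 0 => 0
  | i + 1 => d i

/-- The departure times of the packets `0, …, i - 1` (and `0` in later entries) of an initially
empty single-server FIFO queue with service times `s`, when packet `j` arrives at the
time `f j h` where `h` is the record of the departures of the packets before `j`. -/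
def history (f : ℕ → (ℕ → ℝ) → ℝ) (s : ℕ → ℝ) : ℕ → (ℕ → ℝ)
  | 0 => fun _ => 0
  | i + 1 => Function.update (history f s i) i
      (max (f i (history f s i)) (previous (history f s i) i) + s i)

/-- Arrival time of packet `i`. -/
def arrival (f : ℕ → (ℕ → ℝ) → ℝ) (s : ℕ → ℝ) (i : ℕ) : ℝ := f i (history f s i)

/-- Departure time of packet `i`. -/
def departure (f : ℕ → (ℕ → ℝ) → ℝ) (s : ℕ → ℝ) (i : ℕ) : ℝ := history f s (i + 1) i

theorem history_apply (f : ℕ → (ℕ → ℝ) → ℝ) (s : ℕ → ℝ) {k i : ℕ} (h : k < i) :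
    history f s i k = departure f s k := by
  induction i with
  | zero => omega
  | succ i ih =>
    rcases Nat.lt_succ_iff_lt_or_eq.mp h with h' | rfl
    · rw [history, Function.update_of_ne (by omega), ih h']
    · rfl

/-- The FIFO recursion: service of a packet starts at its arrival or at the previous departure,
whichever is later. -/
theorem departure_eq (f : ℕ → (ℕ → ℝ) → ℝ) (s : ℕ → ℝ) (i : ℕ) :
    departure f s i = max (arrival f s i) (previous (departure f s) i) + s i := by
  have h : previous (history f s i) i = previous (departure f s) i := by
    cases i with
    | zero => rfl
    | succ i => exact history_apply f s (Nat.lt_succ_self i)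
  rw [departure, history, Function.update_self, h, arrival]

/-- A code for `n` packets and `M` messages, in which the arrival times may depend causally on
the departure times. For the message `u`, packet `i` is sent at the time `enc u i d` where only
departures of earlier packets that occur strictly before this time may be used: two departure
records that agree before the time `t = enc u i d` give the same decision to send at `t`. -/
structure FeedbackCode (m : TimeModel) (n M : ℕ) where
  /-- the encoder -/
  enc : Fin M → ℕ → (ℕ → ℝ) → ℝ
  /-- the decoder -/
  dec : (Fin n → ℝ) → Fin M
  measurable_enc : ∀ u, ∀ i < n, Measurable (enc u i)
  measurable_dec : Measurable dec
  causal : ∀ u, ∀ i < n, ∀ d d' : ℕ → ℝ,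
    (∀ k < i, min (d k) (enc u i d) = min (d' k) (enc u i d)) → enc u i d' = enc u i d
  arrival_mem : ∀ u (s : ℕ → ℝ), (∀ k, s k ∈ m.times) → ∀ i < n, arrival (enc u) s i ∈ m.times
  arrival_mono : ∀ u (s : ℕ → ℝ), (∀ k, s k ∈ m.times) → ∀ i j, i ≤ j → j < n →
    arrival (enc u) s i ≤ arrival (enc u) s j

namespace FeedbackCode

variable {m : TimeModel} {n M : ℕ}

/-- A code that makes no use of the feedback: the arrival times depend on the message only. -/
def WithoutFeedback (c : FeedbackCode m n M) : Prop :=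
  ∀ u, ∀ i < n, ∀ d d' : ℕ → ℝ, c.enc u i d = c.enc u i d'

/-- With i.i.d. service times of law `ν` and equiprobable messages, the mean of the last departure
time is at most `T` and the probability of a decoding error is at most `ε`. -/
def Meets (c : FeedbackCode m n M) (ν : Measure ℝ) [IsProbabilityMeasure ν] (T ε : ℝ) : Prop :=
  (∑ u, ∫⁻ s, ENNReal.ofReal (previous (departure (c.enc u) s) n)
      ∂(Measure.infinitePi (fun _ : ℕ => ν))) / (M : ENNReal) ≤ ENNReal.ofReal T ∧
  (∑ u, (Measure.infinitePi (fun _ : ℕ => ν)).real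
      {s | c.dec (fun i : Fin n => departure (c.enc u) s i) ≠ u}) / (M : ℝ) ≤ ε

end FeedbackCode

/-- `R` bits per unit of time are achievable with feedback at the output rate `lam`. -/
def AchievableWithFeedback (m : TimeModel) (ν : Measure ℝ) [IsProbabilityMeasure ν]
    (lam R : ℝ) : Prop :=
  ∀ γ > 0, ∃ ε : ℕ → ℝ, Tendsto ε atTop (𝓝 0) ∧
    ∀ᶠ n : ℕ in atTop, ∃ (M : ℕ) (c : FeedbackCode m n M),
      c.Meets ν (n / lam) (ε n) ∧ R - γ < lam * (Real.logb 2 M / n)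

/-- `R` bits per unit of time are achievable without feedback at the output rate `lam`. -/
def AchievableWithoutFeedback (m : TimeModel) (ν : Measure ℝ) [IsProbabilityMeasure ν]
    (lam R : ℝ) : Prop :=
  ∀ γ > 0, ∃ ε : ℕ → ℝ, Tendsto ε atTop (𝓝 0) ∧
    ∀ᶠ n : ℕ in atTop, ∃ (M : ℕ) (c : FeedbackCode m n M),
      c.WithoutFeedback ∧ c.Meets ν (n / lam) (ε n) ∧ R - γ < lam * (Real.logb 2 M / n)

/-- The capacity `C(lam)` of the queue without feedback at the output rate `lam`. -/
def capacity (m : TimeModel) (ν : Measure ℝ) [IsProbabilityMeasure ν] (lam : ℝ) : EReal :=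
  ⨆ (R : ℝ) (_ : AchievableWithoutFeedback m ν lam R), (R : EReal)

/-- The capacity `C_F(lam)` of the queue with feedback at the output rate `lam`. -/
def feedbackCapacity (m : TimeModel) (ν : Measure ℝ) [IsProbabilityMeasure ν] (lam : ℝ) : EReal :=
  ⨆ (R : ℝ) (_ : AchievableWithFeedback m ν lam R), (R : EReal)

end Queue

end

/-!
Two estimates are compared. Put `a = 1 / lam - 1 / mu`, the mean idle time per packet that the output
rate allows, and write `J` for `maxEntropyDelayed`.

*With feedback*, the encoder sees each departure and can prescribe the idle time `W` before the next
service (`Queue.sendAfter`), so that the gaps between departures are the outputs of the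
memoryless channel `W ↦ W + S`. Every rate below `lam (H(W + S) - H(S))` with `E[W] ≤ a` is then
achievable (`Queue.achievableWithFeedback`). Codebooks come from Feinstein's lemma
(`exists_codewords`) and the law of large numbers. An idle time zero needs care, as a departure is
not known at the time at which it occurs: the packet is sent earlier and waits in the queue.

*Without feedback*, packet `i` finds the server idle for `(X - S)⁺`, where `S` is the service time of
packet `i - 1` and `X` is the arrival time of packet `i` relative to the start of that service. As the
arrival times are fixed in advance, `X` depends on earlier services only, so the gap before the
`i`-th departure has a law of the form `(X - S₁)⁺ + S₂`. Hence the rate is at most `lam (J - H(S))`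
(`Queue.capacity_le`).

The second bound uses neither mutual information nor its chain rule. The departures
are compared with a reference law under which the gaps are independent, all but the first having the
law `τ`, the average over packets and messages of the gap laws of the code. Under the
likelihood ratio the departures are dominated by the reference law
(`Queue.lintegral_history_mul_prod_le`), since each idle time is a function of the past and
the reference measure is invariant under translations. Disjointness of the decoding regions
bounds an exponential moment (`Queue.FeedbackCode.sum_lintegral_exp_le`), and convexity of
the exponential gives Fano's inequality `Queue.FeedbackCode.log_card_le`, in which the mean
log-likelihood ratio is `n (H(τ) - H(S))` up to `O(log n)`. By linearity of the constraint `τ` is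
admissible in `J`, so concavity of the entropy is not needed. The first packet, whose
idle time is arbitrary, is compared with a heavy-tailed law instead and costs `O(log n)`.

Both time models are treated at once through densities with respect to `TimeModel.refMeasure`.
Finiteness of all entropies involved follows from that of `H(S)` by the inequality
`log x ≤ x - 1`, applied to ratios of densities.
-/

noncomputable section

/-! ### Reference measure, densities and entropy -/

namespace TimeModel

/-- The measure with respect to which densities are taken: counting measure on the integers in
discrete time, Lebesgue measure in continuous time. -/
def refMeasure : TimeModel → Measure ℝ
  | discrete => Measure.count.map (fun k : ℤ => (k : ℝ))
  | continuous => volume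

theorem measurableEmbedding_intCast : MeasurableEmbedding (fun k : ℤ => (k : ℝ)) :=
  Int.isClosedEmbedding_coe_real.measurableEmbedding

instance (m : TimeModel) : SigmaFinite m.refMeasure := by
  cases m with
  | discrete => exact measurableEmbedding_intCast.sigmaFinite_map
  | continuous => exact inferInstanceAs (SigmaFinite (volume : Measure ℝ))

theorem lintegral_refMeasure_discrete (g : ℝ → ENNReal) :
    ∫⁻ x, g x ∂discrete.refMeasure = ∑' k : ℤ, g k := by
  rw [refMeasure, measurableEmbedding_intCast.lintegral_map, lintegral_count]

theorem measurableSet_grid (m : TimeModel) : MeasurableSet m.grid := by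
  cases m with
  | discrete => exact measurableEmbedding_intCast.measurableSet_range
  | continuous => exact MeasurableSet.univ

theorem zero_mem_grid (m : TimeModel) : (0 : ℝ) ∈ m.grid := by
  cases m with
  | discrete => exact ⟨0, by simp⟩
  | continuous => trivial

theorem zero_mem_times (m : TimeModel) : (0 : ℝ) ∈ m.times := ⟨m.zero_mem_grid, le_rfl⟩

theorem add_mem_grid (m : TimeModel) {x y : ℝ} (hx : x ∈ m.grid) (hy : y ∈ m.grid) :
    x + y ∈ m.grid := by
  cases m with
  | discrete =>
    obtain ⟨k, rfl⟩ := hx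
    obtain ⟨l, rfl⟩ := hy
    exact ⟨k + l, by simp⟩
  | continuous => trivial

theorem sub_mem_grid (m : TimeModel) {x y : ℝ} (hx : x ∈ m.grid) (hy : y ∈ m.grid) :
    x - y ∈ m.grid := by
  cases m with
  | discrete =>
    obtain ⟨k, rfl⟩ := hx
    obtain ⟨l, rfl⟩ := hy
    exact ⟨k - l, by simp⟩
  | continuous => trivial

theorem max_mem_grid (m : TimeModel) {x y : ℝ} (hx : x ∈ m.grid) (hy : y ∈ m.grid) :
    max x y ∈ m.grid := by
  rcases max_choice x y with h | h <;> rw [h] <;> assumption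

theorem add_mem_times (m : TimeModel) {x y : ℝ} (hx : x ∈ m.times) (hy : y ∈ m.times) :
    x + y ∈ m.times :=
  ⟨m.add_mem_grid hx.1 hy.1, add_nonneg hx.2 hy.2⟩

theorem measurableSet_times (m : TimeModel) : MeasurableSet m.times :=
  m.measurableSet_grid.inter measurableSet_Ici

theorem map_add_refMeasure (m : TimeModel) {c : ℝ} (hc : c ∈ m.grid) :
    m.refMeasure.map (fun x => c + x) = m.refMeasure := by
  cases m with
  | discrete =>
    obtain ⟨k, rfl⟩ := hc
    refine Measure.ext_of_lintegral _ fun g hg => ?_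
    rw [lintegral_map hg (by fun_prop), lintegral_refMeasure_discrete,
      lintegral_refMeasure_discrete, ← (Equiv.addLeft k).tsum_eq (fun l : ℤ => g l)]
    simp
  | continuous => exact map_add_left_eq_self volume c

theorem lintegral_add_refMeasure (m : TimeModel) {c : ℝ} (hc : c ∈ m.grid) {g : ℝ → ENNReal}
    (hg : Measurable g) :
    ∫⁻ x, g (c + x) ∂m.refMeasure = ∫⁻ x, g x ∂m.refMeasure := by
  conv_rhs => rw [← m.map_add_refMeasure hc, lintegral_map hg (by fun_prop)]

theorem absolutelyContinuous_of_discrete {P : Measure ℝ} (hP : ∀ᵐ x ∂P, x ∈ discrete.grid) :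
    P ≪ discrete.refMeasure := by
  refine Measure.AbsolutelyContinuous.mk fun s hs h => ?_
  have h1 : s ∩ discrete.grid = ∅ := by
    rw [← lintegral_indicator_one hs, lintegral_refMeasure_discrete, ENNReal.tsum_eq_zero] at h
    ext x
    simp only [Set.mem_inter_iff, Set.mem_empty_iff_false, iff_false, not_and]
    rintro hx ⟨k, rfl⟩
    simpa [hx] using h k
  refine measure_mono_null (t := discrete.gridᶜ) (fun x hx hx' => ?_) (ae_iff.mp hP)
  exact (h1 ▸ (⟨hx, hx'⟩ : x ∈ s ∩ discrete.grid) : x ∈ (∅ : Set ℝ))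

theorem absolutelyContinuous_of_entropy_ne_bot {m : TimeModel} {P : Measure ℝ}
    (hP : ∀ᵐ x ∂P, x ∈ m.grid) (h : m.entropy P ≠ ⊥) : P ≪ m.refMeasure := by
  cases m with
  | discrete => exact absolutelyContinuous_of_discrete hP
  | continuous =>
    by_contra hc
    exact h (if_neg hc)

/-- The density of a law with respect to the reference measure. -/
def density (m : TimeModel) (P : Measure ℝ) (x : ℝ) : ℝ := (P.rnDeriv m.refMeasure x).toReal

@[fun_prop]
theorem measurable_density (m : TimeModel) (P : Measure ℝ) : Measurable (m.density P) :=
  (Measure.measurable_rnDeriv _ _).ennreal_toReal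

theorem density_nonneg (m : TimeModel) (P : Measure ℝ) (x : ℝ) : 0 ≤ m.density P x :=
  ENNReal.toReal_nonneg

variable {m : TimeModel} {P : Measure ℝ}

theorem ofReal_density [IsProbabilityMeasure P] :
    ∀ᵐ x ∂m.refMeasure, ENNReal.ofReal (m.density P x) = P.rnDeriv m.refMeasure x := by
  filter_upwards [Measure.rnDeriv_lt_top P m.refMeasure] with x hx
  exact ENNReal.ofReal_toReal hx.ne

theorem lintegral_density_mul [IsProbabilityMeasure P] (hP : P ≪ m.refMeasure)
    {g : ℝ → ENNReal} (hg : Measurable g) :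
    ∫⁻ x, ENNReal.ofReal (m.density P x) * g x ∂m.refMeasure = ∫⁻ x, g x ∂P := by
  rw [← lintegral_rnDeriv_mul hP hg.aemeasurable]
  refine lintegral_congr_ae ?_
  filter_upwards [ofReal_density (m := m) (P := P)] with x hx
  rw [hx]

theorem density_pos [IsProbabilityMeasure P] (hP : P ≪ m.refMeasure) :
    ∀ᵐ x ∂P, 0 < m.density P x := by
  filter_upwards [Measure.rnDeriv_pos hP, hP.ae_le (Measure.rnDeriv_lt_top P m.refMeasure)]
    with x hx hx'
  exact ENNReal.toReal_pos hx.ne' hx'.ne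

/-- Importance weighting by `h / f`, where `f` is the density of `P`; only `≤` holds since
the zero set of `f` is lost. -/
theorem lintegral_mul_div_density_le [IsProbabilityMeasure P] (hP : P ≪ m.refMeasure)
    {g : ℝ → ENNReal} (hg : Measurable g) {h : ℝ → ℝ} (hh : Measurable h) :
    ∫⁻ x, g x * ENNReal.ofReal (h x / m.density P x) ∂P
      ≤ ∫⁻ x, g x * ENNReal.ofReal (h x) ∂m.refMeasure := by
  rw [← lintegral_density_mul hP (by fun_prop)]
  refine lintegral_mono fun x => ?_
  rcases (m.density_nonneg P x).eq_or_lt with h0 | h0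
  · simp [← h0]
  · rw [mul_left_comm, ← ENNReal.ofReal_mul h0.le, mul_div_cancel₀ _ h0.ne']

theorem real_singleton_eq_density [IsProbabilityMeasure P] (hP : ∀ᵐ x ∂P, x ∈ discrete.grid) (k : ℤ) :
    P.real {(k : ℝ)} = discrete.density P k := by
  have hac := absolutelyContinuous_of_discrete hP
  have h := lintegral_density_mul (m := discrete) hac
    (g := Set.indicator {(k : ℝ)} 1) (measurable_one.indicator (measurableSet_singleton _))
  rw [lintegral_indicator_one (measurableSet_singleton _), lintegral_refMeasure_discrete,
    tsum_eq_single k] at h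
  · simp only [Set.mem_singleton_iff, Set.indicator_of_mem, Pi.one_apply, mul_one] at h
    rw [Measure.real, ← h, ENNReal.toReal_ofReal (density_nonneg _ _ _)]
  · intro l hl
    simp [hl]

/-- In both models the entropy of `P` is the mean of `-log₂ f` under `P`, where `f` is the density
of `P`, in the form of the difference of the means of the positive and of the negative part. -/
theorem entropy_eq [IsProbabilityMeasure P] (hP : ∀ᵐ x ∂P, x ∈ m.grid)
    (hac : P ≪ m.refMeasure) :
    m.entropy P = ((∫⁻ x, ENNReal.ofReal (-Real.logb 2 (m.density P x)) ∂P : ENNReal) : EReal)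
      - ((∫⁻ x, ENNReal.ofReal (Real.logb 2 (m.density P x)) ∂P : ENNReal) : EReal) := by
  have hm : Measurable fun x => Real.logb 2 (m.density P x) :=
    (Real.measurable_log.comp (m.measurable_density P)).div_const _
  have h1 : ∫⁻ x, ENNReal.ofReal (-Real.logb 2 (m.density P x)) ∂P
      = ∫⁻ x, ENNReal.ofReal (-(m.density P x * Real.logb 2 (m.density P x))) ∂m.refMeasure := by
    rw [← lintegral_density_mul hac (by fun_prop)]
    refine lintegral_congr fun x => ?_
    rw [← ENNReal.ofReal_mul (m.density_nonneg P x), mul_neg]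
  have h2 : ∫⁻ x, ENNReal.ofReal (Real.logb 2 (m.density P x)) ∂P
      = ∫⁻ x, ENNReal.ofReal (m.density P x * Real.logb 2 (m.density P x)) ∂m.refMeasure := by
    rw [← lintegral_density_mul hac (by fun_prop)]
    refine lintegral_congr fun x => ?_
    rw [← ENNReal.ofReal_mul (m.density_nonneg P x)]
  rw [h1, h2]
  cases m with
  | continuous => exact if_pos hac
  | discrete =>
    rw [lintegral_refMeasure_discrete, lintegral_refMeasure_discrete]
    have h3 : ∀ k : ℤ, ENNReal.ofReal (discrete.density P k *
        Real.logb 2 (discrete.density P k)) = 0 := by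
      intro k
      rw [← real_singleton_eq_density hP, ENNReal.ofReal_eq_zero]
      exact mul_nonpos_of_nonneg_of_nonpos measureReal_nonneg
        (Real.logb_nonpos (by norm_num) measureReal_nonneg measureReal_le_one)
    simp only [h3, tsum_zero, EReal.coe_ennreal_zero, sub_zero]
    simp only [entropy, shannonEntropy, real_singleton_eq_density hP]

theorem lintegral_inv_one_add_sq_lt_top (m : TimeModel) :
    ∫⁻ x, ENNReal.ofReal (1 + x ^ 2)⁻¹ ∂m.refMeasure < ⊤ := by
  cases m with
  | continuous =>
    exact (hasFiniteIntegral_iff_ofReal (ae_of_all _ fun x => by positivity)).mp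
      integrable_inv_one_add_sq.2
  | discrete =>
    rw [lintegral_refMeasure_discrete]
    have h : Summable fun k : ℤ => (1 + (k : ℝ) ^ 2)⁻¹ := by
      have h0 : Summable fun k : ℤ => 1 / (k : ℝ) ^ 2 :=
        Real.summable_one_div_int_pow.mpr (by norm_num)
      refine Summable.of_norm_bounded_eventually h0 ?_
      filter_upwards [(Set.finite_singleton (0 : ℤ)).compl_mem_cofinite] with k hk
      have hk' : (k : ℝ) ≠ 0 := by exact_mod_cast hk
      rw [Real.norm_of_nonneg (by positivity), one_div]
      gcongr
      linarith
    exact h.tsum_ofReal_lt_top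

theorem log_one_add_sq_le {x : ℝ} (hx : 0 ≤ x) : Real.log (1 + x ^ 2) ≤ 2 * x := by
  have h1 : 1 + x ^ 2 ≤ (1 + x) ^ 2 := by nlinarith
  calc Real.log (1 + x ^ 2) ≤ Real.log ((1 + x) ^ 2) := Real.log_le_log (by positivity) h1
    _ = 2 * Real.log (1 + x) := by rw [Real.log_pow]; norm_num
    _ ≤ 2 * x := by
      have := Real.log_le_sub_one_of_pos (by linarith : 0 < 1 + x)
      linarith

/-- A law on the half-line with finite mean has entropy `< ∞`; comparison with the density
proportional to `(1 + x²)⁻¹`. -/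
theorem lintegral_neg_log_density_lt_top [IsProbabilityMeasure P] (hP : ∀ᵐ x ∂P, x ∈ m.times)
    (hac : P ≪ m.refMeasure) (hint : Integrable (fun x : ℝ => x) P) :
    ∫⁻ x, ENNReal.ofReal (-Real.log (m.density P x)) ∂P < ⊤ := by
  have hA : ∫⁻ x, ENNReal.ofReal ((1 + x ^ 2)⁻¹ / m.density P x) ∂P < ⊤ := by
    refine lt_of_le_of_lt ?_ m.lintegral_inv_one_add_sq_lt_top
    simpa using lintegral_mul_div_density_le hac measurable_one
      (h := fun x => (1 + x ^ 2)⁻¹) (by fun_prop)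
  have hB : ∫⁻ x, ENNReal.ofReal (2 * x) ∂P < ⊤ := (hint.const_mul 2).lintegral_lt_top
  calc ∫⁻ x, ENNReal.ofReal (-Real.log (m.density P x)) ∂P
      ≤ ∫⁻ x, (ENNReal.ofReal ((1 + x ^ 2)⁻¹ / m.density P x) + ENNReal.ofReal (2 * x)) ∂P := by
        refine lintegral_mono_ae ?_
        filter_upwards [hP, density_pos hac] with x hx hf
        rw [← ENNReal.ofReal_add (by positivity) (by linarith [hx.2])]
        refine ENNReal.ofReal_le_ofReal ?_
        have h1 : 0 < (1 + x ^ 2)⁻¹ / m.density P x := by positivity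
        have h2 := Real.log_le_sub_one_of_pos h1
        rw [Real.log_div (by positivity) hf.ne', Real.log_inv] at h2
        linarith [log_one_add_sq_le hx.2]
    _ < ⊤ := by
        rw [lintegral_add_right _ (by fun_prop)]
        exact ENNReal.add_lt_top.mpr ⟨hA, hB⟩

theorem lintegral_ofReal_logb (c : ℝ) :
    ∫⁻ x, ENNReal.ofReal (c * Real.logb 2 (m.density P x)) ∂P
      = ENNReal.ofReal (Real.log 2)⁻¹ * ∫⁻ x, ENNReal.ofReal (c * Real.log (m.density P x)) ∂P := by
  rw [← lintegral_const_mul' _ _ (by simp)]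
  refine lintegral_congr fun x => ?_
  rw [← ENNReal.ofReal_mul (by positivity), Real.logb]
  congr 1
  field_simp

theorem lintegral_log_density_lt_top [IsProbabilityMeasure P] (hP : ∀ᵐ x ∂P, x ∈ m.grid)
    (h : m.entropy P ≠ ⊥) : ∫⁻ x, ENNReal.ofReal (Real.log (m.density P x)) ∂P < ⊤ := by
  have hac := absolutelyContinuous_of_entropy_ne_bot hP h
  rw [entropy_eq hP hac] at h
  by_contra hc
  have h1 := lintegral_ofReal_logb (m := m) (P := P) 1
  simp only [one_mul] at h1
  rw [not_lt_top_iff.mp hc, ENNReal.mul_top (by simp; positivity)] at h1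
  rw [h1] at h
  exact h (by simp)

theorem integrable_log_density [IsProbabilityMeasure P] (hP : ∀ᵐ x ∂P, x ∈ m.times)
    (hac : P ≪ m.refMeasure) (hint : Integrable (fun x : ℝ => x) P)
    (h : ∫⁻ x, ENNReal.ofReal (Real.log (m.density P x)) ∂P < ⊤) :
    Integrable (fun x => Real.log (m.density P x)) P := by
  have hm : Measurable fun x => Real.log (m.density P x) := by fun_prop
  refine ⟨hm.aestronglyMeasurable, ?_⟩
  have h2 := lintegral_neg_log_density_lt_top hP hac hint
  calc ∫⁻ x, ‖Real.log (m.density P x)‖ₑ ∂P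
      ≤ ∫⁻ x, (ENNReal.ofReal (Real.log (m.density P x))
          + ENNReal.ofReal (-Real.log (m.density P x))) ∂P := by
        refine lintegral_mono fun x => ?_
        rw [← ofReal_norm, Real.norm_eq_abs]
        rcases abs_cases (Real.log (m.density P x)) with ⟨h, _⟩ | ⟨h, _⟩ <;> rw [h]
        · exact le_self_add
        · exact le_add_self
    _ < ⊤ := by
        rw [lintegral_add_right _ (by fun_prop)]
        exact ENNReal.add_lt_top.mpr ⟨h, h2⟩

theorem entropy_eq_integral [IsProbabilityMeasure P] (hP : ∀ᵐ x ∂P, x ∈ m.grid)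
    (hac : P ≪ m.refMeasure) (h : Integrable (fun x => Real.log (m.density P x)) P) :
    m.entropy P = ((-(∫ x, Real.log (m.density P x) ∂P) / Real.log 2 : ℝ) : EReal) := by
  have h1 := lintegral_ofReal_logb (m := m) (P := P) 1
  have h2 := lintegral_ofReal_logb (m := m) (P := P) (-1)
  simp only [one_mul, neg_mul] at h1 h2
  have hn : ∫⁻ x, ENNReal.ofReal (-Real.log (m.density P x)) ∂P ≠ ⊤ := h.neg.lintegral_lt_top.ne
  have hl : (0 : ℝ) ≤ (Real.log 2)⁻¹ := inv_nonneg.mpr (Real.log_nonneg (by norm_num))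
  rw [entropy_eq hP hac, h1, h2, integral_eq_lintegral_pos_part_sub_lintegral_neg_part h,
    ← ENNReal.ofReal_toReal h.lintegral_lt_top.ne,
    ← ENNReal.ofReal_toReal hn]
  rw [← ENNReal.ofReal_mul hl, ← ENNReal.ofReal_mul hl, EReal.coe_ennreal_ofReal,
    EReal.coe_ennreal_ofReal, max_eq_left (by positivity), max_eq_left (by positivity),
    ← EReal.coe_sub, ENNReal.toReal_ofReal ENNReal.toReal_nonneg,
    ENNReal.toReal_ofReal ENNReal.toReal_nonneg]
  congr 1
  ring

/-! ### The channel that adds an independent service time -/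

/-- The law of `W + S`, where `W` of law `P` and `S` of law `ν` are independent. -/
def addLaw (P ν : Measure ℝ) : Measure ℝ := (P.prod ν).map (fun z : ℝ × ℝ => z.1 + z.2)

variable {ν τ : Measure ℝ}

instance [IsProbabilityMeasure P] [IsProbabilityMeasure ν] : IsProbabilityMeasure (addLaw P ν) :=
  Measure.isProbabilityMeasure_map (by fun_prop)

theorem lintegral_addLaw [IsProbabilityMeasure P] [IsProbabilityMeasure ν] {g : ℝ → ENNReal}
    (hg : Measurable g) :
    ∫⁻ x, g x ∂addLaw P ν = ∫⁻ w, ∫⁻ s, g (w + s) ∂ν ∂P := by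
  rw [addLaw, lintegral_map hg (by fun_prop), lintegral_prod _ (by fun_prop)]

/-- Change of measure for one use of the channel with input `w`: the output `w + S`, weighted
by the ratio of the densities of `τ` and of the output, is dominated by `τ`. -/
theorem lintegral_shift_mul_density_div_le [IsProbabilityMeasure τ] [IsProbabilityMeasure ν]
    (hτ : τ ≪ m.refMeasure) (hν : ν ≪ m.refMeasure) {w : ℝ} (hw : w ∈ m.grid)
    {g : ℝ → ENNReal} (hg : Measurable g) :
    ∫⁻ s, g (w + s) * ENNReal.ofReal (m.density τ (w + s) / m.density ν s) ∂ν
      ≤ ∫⁻ x, g x ∂τ := by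
  refine (lintegral_mul_div_density_le hν (g := fun s => g (w + s))
    (h := fun s => m.density τ (w + s)) (by fun_prop) (by fun_prop)).trans_eq ?_
  rw [m.lintegral_add_refMeasure hw (g := fun x => g x * ENNReal.ofReal (m.density τ x))
    (by fun_prop), ← lintegral_density_mul hτ hg]
  simp only [mul_comm]

theorem addLaw_mem_times [IsProbabilityMeasure P] [IsProbabilityMeasure ν]
    (hP : ∀ᵐ w ∂P, w ∈ m.times) (hν : ∀ᵐ s ∂ν, s ∈ m.times) :
    ∀ᵐ x ∂addLaw P ν, x ∈ m.times := by
  refine (ae_map_iff (p := fun x => x ∈ m.times) (by fun_prop) m.measurableSet_times).mpr ?_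
  filter_upwards [Measure.quasiMeasurePreserving_fst.ae hP,
    Measure.quasiMeasurePreserving_snd.ae hν] with z h1 h2
  exact m.add_mem_times h1 h2

theorem addLaw_absolutelyContinuous [IsProbabilityMeasure P] [IsProbabilityMeasure ν]
    (hP : ∀ᵐ w ∂P, w ∈ m.grid) (hν : ν ≪ m.refMeasure) : addLaw P ν ≪ m.refMeasure := by
  refine Measure.AbsolutelyContinuous.mk fun s hs h => ?_
  rw [← lintegral_indicator_one hs, lintegral_addLaw (measurable_one.indicator hs)]
  refine (lintegral_eq_zero_iff' ?_).mpr ?_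
  · exact (Measurable.lintegral_prod_right' (f := fun z : ℝ × ℝ => s.indicator 1 (z.1 + z.2))
      ((measurable_one.indicator hs).comp (by fun_prop))).aemeasurable
  · filter_upwards [hP] with w hw
    have h1 : m.refMeasure ((fun x => w + x) ⁻¹' s) = 0 := by
      rw [← Measure.map_apply (by fun_prop) hs, m.map_add_refMeasure hw, h]
    have h2 := hν h1
    rw [← lintegral_indicator_one (measurableSet_preimage (by fun_prop) hs)] at h2
    exact h2

theorem integrable_addLaw [IsProbabilityMeasure P] [IsProbabilityMeasure ν]
    (hP : Integrable (fun x : ℝ => x) P) (hν : Integrable (fun x : ℝ => x) ν) :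
    Integrable (fun x : ℝ => x) (addLaw P ν) := by
  rw [addLaw, integrable_map_measure (by fun_prop) (by fun_prop)]
  exact (hP.comp_fst ν).add (hν.comp_snd P)

/-- Adding an independent variable does not decrease the entropy below `-∞`. -/
theorem lintegral_log_density_addLaw_lt_top [IsProbabilityMeasure P] [IsProbabilityMeasure ν]
    (hP : ∀ᵐ w ∂P, w ∈ m.grid) (hac : ν ≪ m.refMeasure)
    (h : ∫⁻ x, ENNReal.ofReal (Real.log (m.density ν x)) ∂ν < ⊤) :
    ∫⁻ x, ENNReal.ofReal (Real.log (m.density (addLaw P ν) x)) ∂addLaw P ν < ⊤ := by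
  have hac' := addLaw_absolutelyContinuous hP hac
  have hm : Measurable fun x => Real.log (m.density (addLaw P ν) x) := by fun_prop
  have hpos : ∀ᵐ w ∂P, ∀ᵐ s ∂ν, 0 < m.density (addLaw P ν) (w + s) := by
    have h1 := density_pos hac'
    rw [addLaw, ae_map_iff (by fun_prop) (measurableSet_lt (by fun_prop) (by fun_prop))] at h1
    exact Measure.ae_ae_of_ae_prod h1
  rw [lintegral_addLaw (by fun_prop)]
  calc ∫⁻ w, ∫⁻ s, ENNReal.ofReal (Real.log (m.density (addLaw P ν) (w + s))) ∂ν ∂P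
      ≤ ∫⁻ _, (1 + ∫⁻ s, ENNReal.ofReal (Real.log (m.density ν s)) ∂ν) ∂P := by
        refine lintegral_mono_ae ?_
        filter_upwards [hP, hpos] with w hw hw'
        have h2 := lintegral_shift_mul_density_div_le hac' hac hw measurable_one
        simp only [Pi.one_apply, one_mul, lintegral_const, measure_univ, mul_one] at h2
        refine le_trans ?_ (add_le_add_left h2 _)
        rw [← lintegral_add_right _ (by fun_prop)]
        refine lintegral_mono_ae ?_
        filter_upwards [hw', density_pos hac] with s h3 h4
        refine le_trans (ENNReal.ofReal_le_ofReal ?_) ENNReal.ofReal_add_le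
        have h5 := Real.log_le_sub_one_of_pos (div_pos h3 h4)
        rw [Real.log_div h3.ne' h4.ne'] at h5
        linarith
    _ < ⊤ := by simpa using h

/-- A service law of finite mean whose entropy is not `-∞`. -/
structure IsService (m : TimeModel) (ν : Measure ℝ) : Prop where
  mem_times : ∀ᵐ s ∂ν, s ∈ m.times
  integrable : Integrable (fun s : ℝ => s) ν
  absolutelyContinuous : ν ≪ m.refMeasure
  integrable_log : Integrable (fun s => Real.log (m.density ν s)) ν

theorem IsService.of_entropy_ne_bot [IsProbabilityMeasure ν] (h1 : ∀ᵐ s ∂ν, s ∈ m.times)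
    (h2 : Integrable (fun s : ℝ => s) ν) (h3 : m.entropy ν ≠ ⊥) : IsService m ν := by
  have hg : ∀ᵐ s ∂ν, s ∈ m.grid := h1.mono fun s hs => hs.1
  have hac := absolutelyContinuous_of_entropy_ne_bot hg h3
  exact ⟨h1, h2, hac, integrable_log_density h1 hac h2 (lintegral_log_density_lt_top hg h3)⟩

theorem IsService.entropy [IsProbabilityMeasure ν] (h : IsService m ν) :
    m.entropy ν = ((-(∫ x, Real.log (m.density ν x) ∂ν) / Real.log 2 : ℝ) : EReal) :=
  entropy_eq_integral (h.mem_times.mono fun _ hs => hs.1) h.absolutelyContinuous h.integrable_log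

theorem IsService.addLaw [IsProbabilityMeasure P] [IsProbabilityMeasure ν] (h : IsService m ν)
    (hP : ∀ᵐ w ∂P, w ∈ m.times) (hint : Integrable (fun w : ℝ => w) P) :
    IsService m (addLaw P ν) := by
  have hg : ∀ᵐ s ∂P, s ∈ m.grid := hP.mono fun s hs => hs.1
  have h1 := addLaw_mem_times hP h.mem_times
  have h2 := addLaw_absolutelyContinuous hg h.absolutelyContinuous
  have h3 := integrable_addLaw hint h.integrable
  exact ⟨h1, h3, h2, integrable_log_density h1 h2 h3
    (lintegral_log_density_addLaw_lt_top hg h.absolutelyContinuous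
      h.integrable_log.lintegral_lt_top)⟩

theorem integrable_of_lintegral_ofReal_le [IsProbabilityMeasure P] {a : ℝ}
    (hP : ∀ᵐ w ∂P, w ∈ m.times) (h : ∫⁻ w, ENNReal.ofReal w ∂P ≤ ENNReal.ofReal a) :
    Integrable (fun w : ℝ => w) P := by
  refine ⟨by fun_prop, ?_⟩
  rw [hasFiniteIntegral_iff_ofReal (hP.mono fun _ h => h.2)]
  exact h.trans_lt ENNReal.ofReal_lt_top

end TimeModel

/-! ### Independent sequences and the recursion of the queue -/

/-- The law of a sequence of independent variables of law `ν`. -/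
abbrev iidLaw (ν : Measure ℝ) [IsProbabilityMeasure ν] : Measure (ℕ → ℝ) :=
  Measure.infinitePi (fun _ : ℕ => ν)

section Iid

variable {ν : Measure ℝ} [IsProbabilityMeasure ν]

theorem iidLaw_ae {p : ℝ → Prop} (h : ∀ᵐ x ∂ν, p x) : ∀ᵐ s ∂iidLaw ν, ∀ i, p (s i) :=
  ae_all_iff.mpr fun i =>
    (measurePreserving_eval_infinitePi (fun _ : ℕ => ν) i).quasiMeasurePreserving.ae h

theorem integrable_eval_iidLaw {g : ℝ → ℝ} (hg : Integrable g ν) (i : ℕ) :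
    Integrable (fun s : ℕ → ℝ => g (s i)) (iidLaw ν) :=
  (measurePreserving_eval_infinitePi (fun _ : ℕ => ν) i).integrable_comp_of_integrable hg

theorem integral_eval_iidLaw {g : ℝ → ℝ} (hg : Integrable g ν) (i : ℕ) :
    ∫ s : ℕ → ℝ, g (s i) ∂iidLaw ν = ∫ x, g x ∂ν := by
  have h := Measure.infinitePi_map_eval (fun _ : ℕ => ν) i
  conv_rhs => rw [← h]
  rw [integral_map (measurable_pi_apply i).aemeasurable]
  rw [h]
  exact hg.1

/-- A variable that depends on the first `n` terms only is independent of the next two terms. -/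
theorem map_past_prod_next_two {E : Type*} [MeasurableSpace E] {X : (ℕ → ℝ) → E} {n : ℕ}
    (hX : Measurable X) (hpast : ∀ s s' : ℕ → ℝ, (∀ k < n, s k = s' k) → X s = X s') :
    (iidLaw ν).map (fun s => (X s, (s n, s (n + 1)))) = ((iidLaw ν).map X).prod (ν.prod ν) := by
  have hi := (ProbabilityTheory.iIndepFun_infinitePi (P := fun _ : ℕ => ν)
    (X := fun _ x => x) (fun _ => measurable_id)).indepFun_finset (Finset.range n)
    ({n, n + 1} : Finset ℕ) (by simp) (fun i => by fun_prop)
  let φ : (Finset.range n → ℝ) → E :=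
    fun x => X (fun k => if h : k ∈ Finset.range n then x ⟨k, h⟩ else 0)
  let ψ : (({n, n + 1} : Finset ℕ) → ℝ) → ℝ × ℝ :=
    fun y => (y ⟨n, by simp⟩, y ⟨n + 1, by simp⟩)
  have hφ : Measurable φ := by
    refine hX.comp (measurable_pi_lambda _ fun k => ?_)
    by_cases h : k ∈ Finset.range n
    · simp only [h, dite_true]; fun_prop
    · simp only [h, dite_false]; fun_prop
  have h := hi.comp hφ (by fun_prop : Measurable ψ)
  have h1 : φ ∘ (fun (s : ℕ → ℝ) (i : Finset.range n) => s i) = X := by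
    funext s
    refine hpast _ _ fun k hk => ?_
    simp [hk]
  have h2 : ψ ∘ (fun (s : ℕ → ℝ) (i : ({n, n + 1} : Finset ℕ)) => s i)
      = fun s => (s n, s (n + 1)) := rfl
  rw [h1, h2] at h
  rw [h.map_prod_eq_prod_map_map hX.aemeasurable (by fun_prop),
    Measure.infinitePi_map_eval_prod (P := fun _ : ℕ => ν) (by omega)]

theorem lintegral_past_next_two {E : Type*} [MeasurableSpace E] {X : (ℕ → ℝ) → E} {n : ℕ}
    (hX : Measurable X) (hpast : ∀ s s' : ℕ → ℝ, (∀ k < n, s k = s' k) → X s = X s')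
    {F : E → ℝ → ℝ → ENNReal} (hF : Measurable fun z : E × ℝ × ℝ => F z.1 z.2.1 z.2.2) :
    ∫⁻ s, F (X s) (s n) (s (n + 1)) ∂iidLaw ν
      = ∫⁻ s, ∫⁻ a, ∫⁻ b, F (X s) a b ∂ν ∂ν ∂iidLaw ν := by
  have h1 := lintegral_map (μ := iidLaw ν) hF
    (by fun_prop : Measurable (fun s : ℕ → ℝ => (X s, (s n, s (n + 1)))))
  have h2 : Measurable fun x : E => ∫⁻ z : ℝ × ℝ, F x z.1 z.2 ∂ν.prod ν :=
    Measurable.lintegral_prod_right' (f := fun z : E × ℝ × ℝ => F z.1 z.2.1 z.2.2) hF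
  rw [← h1, map_past_prod_next_two hX hpast, lintegral_prod _ hF.aemeasurable,
    lintegral_map h2 hX]
  refine lintegral_congr fun s => ?_
  rw [lintegral_prod]
  exact (hF.comp (by fun_prop : Measurable fun z : ℝ × ℝ => (X s, z.1, z.2))).aemeasurable

theorem lintegral_past_next {E : Type*} [MeasurableSpace E] {X : (ℕ → ℝ) → E} {n : ℕ}
    (hX : Measurable X) (hpast : ∀ s s' : ℕ → ℝ, (∀ k < n, s k = s' k) → X s = X s')
    {F : E → ℝ → ENNReal} (hF : Measurable fun z : E × ℝ => F z.1 z.2) :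
    ∫⁻ s, F (X s) (s n) ∂iidLaw ν = ∫⁻ s, ∫⁻ a, F (X s) a ∂ν ∂iidLaw ν := by
  have h := lintegral_past_next_two (ν := ν) hX hpast (F := fun x a _ => F x a)
    (hF.comp (by fun_prop : Measurable fun z : E × ℝ × ℝ => (z.1, z.2.1)))
  simpa using h

end Iid

namespace Queue

@[fun_prop]
theorem measurable_previous (i : ℕ) : Measurable fun d : ℕ → ℝ => previous d i := by
  cases i with
  | zero => exact measurable_const
  | succ i => exact measurable_pi_apply i

/-- The time at which the service of packet `i` starts. -/
def start (f : ℕ → (ℕ → ℝ) → ℝ) (s : ℕ → ℝ) (i : ℕ) : ℝ :=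
  max (arrival f s i) (previous (history f s i) i)

/-- The time for which the server is idle before packet `i`. -/
def idle (f : ℕ → (ℕ → ℝ) → ℝ) (s : ℕ → ℝ) (i : ℕ) : ℝ :=
  start f s i - previous (history f s i) i

section Recursion

variable {f : ℕ → (ℕ → ℝ) → ℝ} {s s' : ℕ → ℝ} {i n N : ℕ}

theorem history_congr (h : ∀ k < n, s k = s' k) : history f s n = history f s' n := by
  induction n with
  | zero => rfl
  | succ n ih =>
    rw [history, history, ih fun k hk => h k (by omega), h n (by omega)]

theorem start_congr (h : ∀ k < n, s k = s' k) : start f s n = start f s' n := by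
  rw [start, start, arrival, arrival, history_congr h]

theorem idle_congr (h : ∀ k < n, s k = s' k) : idle f s n = idle f s' n := by
  rw [idle, idle, start_congr h, history_congr h]

theorem departure_eq_start : departure f s i = start f s i + s i := by
  rw [departure, history, Function.update_self]
  rfl

theorem previous_history : previous (history f s i) i = previous (departure f s) i := by
  cases i with
  | zero => rfl
  | succ i => rfl

theorem idle_nonneg : 0 ≤ idle f s i := sub_nonneg.mpr (le_max_right _ _)

theorem previous_departure_add : previous (departure f s) i + (idle f s i + s i)
    = departure f s i := by
  rw [departure_eq_start, idle, previous_history]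
  ring

theorem previous_departure_eq_sum :
    previous (departure f s) n = ∑ i ∈ Finset.range n, (idle f s i + s i) := by
  induction n with
  | zero => rfl
  | succ n ih => rw [Finset.sum_range_succ, ← ih, previous_departure_add]; rfl

theorem history_succ : history f s (n + 1)
    = Function.update (history f s n) n (previous (history f s n) n + (idle f s n + s n)) := by
  rw [history, idle, start, arrival]
  congr 1
  ring

theorem measurable_history (hf : ∀ j < N, Measurable (f j)) (hn : n ≤ N) : Measurable fun s => history f s n := by
  induction n with
  | zero => exact measurable_const
  | succ n ih =>
    have h1 := ih (by omega)
    have h2 : Measurable fun s : ℕ → ℝ =>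
        max (f n (history f s n)) (previous (history f s n) n) + s n :=
      (((hf n (by omega)).comp h1).max ((measurable_previous n).comp h1)).add
        (measurable_pi_apply n)
    exact measurable_update'.comp (h1.prodMk h2)

theorem measurable_start (hf : ∀ j < N, Measurable (f j)) (hn : n < N) : Measurable fun s => start f s n :=
  ((hf n hn).comp (measurable_history hf hn.le)).max
    ((measurable_previous n).comp (measurable_history hf hn.le))

theorem measurable_idle (hf : ∀ j < N, Measurable (f j)) (hn : n < N) : Measurable fun s => idle f s n :=
  (measurable_start hf hn).sub ((measurable_previous n).comp (measurable_history hf hn.le))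

theorem previous_departure_mem_grid {m : TimeModel} (hs : ∀ k, s k ∈ m.times)
    (ha : ∀ i < N, arrival f s i ∈ m.grid) (hn : n ≤ N) :
    previous (departure f s) n ∈ m.grid := by
  induction n with
  | zero => exact m.zero_mem_grid
  | succ n ih =>
    change departure f s n ∈ m.grid
    rw [departure_eq]
    exact m.add_mem_grid (m.max_mem_grid (ha n (by omega)) (ih (by omega))) (hs n).1

theorem start_mem_grid {m : TimeModel} (hs : ∀ k, s k ∈ m.times)
    (ha : ∀ i < N, arrival f s i ∈ m.grid) (hn : n < N) : start f s n ∈ m.grid := by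
  rw [start, previous_history]
  exact m.max_mem_grid (ha n hn) (previous_departure_mem_grid hs ha hn.le)

theorem idle_mem_times {m : TimeModel} (hs : ∀ k, s k ∈ m.times)
    (ha : ∀ i < N, arrival f s i ∈ m.grid) (hn : n < N) : idle f s n ∈ m.times := by
  refine ⟨?_, idle_nonneg⟩
  rw [idle, previous_history]
  exact m.sub_mem_grid (start_mem_grid hs ha hn) (previous_departure_mem_grid hs ha hn.le)

end Recursion

/-! ### Change of measure for the queue -/

/-- The law of the record of `n` departures if the times between departures are independent,
the `i`-th one having the law `τ i`. -/
def departureLaw (τ : ℕ → Measure ℝ) : ℕ → Measure (ℕ → ℝ)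
  | 0 => Measure.dirac (fun _ => 0)
  | n + 1 => ((departureLaw τ n).prod (τ n)).map
      (fun z => Function.update z.1 n (previous z.1 n + z.2))

theorem measurable_departureStep (n : ℕ) : Measurable fun z : (ℕ → ℝ) × ℝ =>
    Function.update z.1 n (previous z.1 n + z.2) :=
  measurable_update'.comp (measurable_fst.prodMk
    (((measurable_previous n).comp measurable_fst).add measurable_snd))

instance (τ : ℕ → Measure ℝ) [∀ i, IsProbabilityMeasure (τ i)] (n : ℕ) :
    IsProbabilityMeasure (departureLaw τ n) := by
  induction n with
  | zero => exact inferInstanceAs (IsProbabilityMeasure (Measure.dirac _))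
  | succ n ih => exact Measure.isProbabilityMeasure_map (measurable_departureStep n).aemeasurable

/-- Whatever the encoder, the law of the departures, weighted by the likelihood ratio, is dominated
by the law with independent times between departures: each idle time is a function of the past, so
that the one-step change of measure applies packet by packet. -/
theorem lintegral_history_mul_prod_le {m : TimeModel} {ν : Measure ℝ} [IsProbabilityMeasure ν]
    (hS : ∀ᵐ s ∂ν, s ∈ m.times) (hν : ν ≪ m.refMeasure)
    {τ : ℕ → Measure ℝ} [∀ i, IsProbabilityMeasure (τ i)] (hτ : ∀ i, τ i ≪ m.refMeasure)
    {f : ℕ → (ℕ → ℝ) → ℝ} {N : ℕ} (hf : ∀ j < N, Measurable (f j))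
    (hmem : ∀ s : ℕ → ℝ, (∀ k, s k ∈ m.times) → ∀ i < N, arrival f s i ∈ m.grid)
    {n : ℕ} (hn : n ≤ N) {g : (ℕ → ℝ) → ENNReal} (hg : Measurable g) :
    ∫⁻ s, g (history f s n) * ∏ i ∈ Finset.range n, ENNReal.ofReal
        (m.density (τ i) (idle f s i + s i) / m.density ν (s i)) ∂iidLaw ν
      ≤ ∫⁻ d, g d ∂departureLaw τ n := by
  induction n generalizing g with
  | zero => simp [history, departureLaw, lintegral_dirac' _ hg]
  | succ n ih =>
    let p : (ℕ → ℝ) → ENNReal := fun s => ∏ i ∈ Finset.range n, ENNReal.ofReal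
        (m.density (τ i) (idle f s i + s i) / m.density ν (s i))
    have hp : Measurable p := by
      refine Finset.measurable_prod _ fun i hi => ?_
      have hi' : i < N := by have := Finset.mem_range.mp hi; omega
      have := measurable_idle hf hi'
      fun_prop
    have hp' : ∀ s s' : ℕ → ℝ, (∀ k < n, s k = s' k) → p s = p s' := by
      intro s s' h
      refine Finset.prod_congr rfl fun i hi => ?_
      have hi' := Finset.mem_range.mp hi
      rw [idle_congr fun k hk => h k (hk.trans hi'), h i hi']
    have hh := measurable_history hf (n := n) (by omega)
    have hw := measurable_idle hf (n := n) (by omega)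
    have hG : Measurable fun z : (ℕ → ℝ) × ℝ =>
        g (Function.update z.1 n (previous z.1 n + z.2)) := hg.comp (measurable_departureStep n)
    let F : (ℕ → ℝ) × ENNReal × ℝ → ℝ → ENNReal := fun x a =>
      g (Function.update x.1 n (previous x.1 n + (x.2.2 + a)))
        * (x.2.1 * ENNReal.ofReal (m.density (τ n) (x.2.2 + a) / m.density ν a))
    have hF : Measurable fun z : ((ℕ → ℝ) × ENNReal × ℝ) × ℝ => F z.1 z.2 := by
      have h1 : Measurable fun z : ((ℕ → ℝ) × ENNReal × ℝ) × ℝ => z.1.2.2 + z.2 := by fun_prop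
      have h2 : Measurable fun z : ((ℕ → ℝ) × ENNReal × ℝ) × ℝ => z.1.1 := by fun_prop
      exact (hG.comp (h2.prodMk h1)).mul (by fun_prop)
    calc ∫⁻ s, g (history f s (n + 1)) * ∏ i ∈ Finset.range (n + 1), ENNReal.ofReal
          (m.density (τ i) (idle f s i + s i) / m.density ν (s i)) ∂iidLaw ν
        = ∫⁻ s, F (history f s n, p s, idle f s n) (s n) ∂iidLaw ν := by
          refine lintegral_congr fun s => ?_
          rw [history_succ, Finset.prod_range_succ]
      _ = ∫⁻ s, ∫⁻ a, F (history f s n, p s, idle f s n) a ∂ν ∂iidLaw ν :=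
          lintegral_past_next (X := fun s => (history f s n, p s, idle f s n))
            (hh.prodMk (hp.prodMk hw))
            (fun s s' h => by rw [history_congr h, hp' s s' h, idle_congr h]) hF
      _ ≤ ∫⁻ s, (∫⁻ y, g (Function.update (history f s n) n
            (previous (history f s n) n + y)) ∂τ n) * p s ∂iidLaw ν := by
          refine lintegral_mono_ae ?_
          filter_upwards [iidLaw_ae hS] with s hs
          have hg' : Measurable fun y => g (Function.update (history f s n) n
              (previous (history f s n) n + y)) :=
            hG.comp (measurable_const.prodMk measurable_id)
          have h1 := TimeModel.lintegral_shift_mul_density_div_le (hτ n) hν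
            (idle_mem_times hs (hmem s hs) (n := n) (by omega)).1 hg'
          refine le_trans (le_of_eq ?_) (mul_le_mul_left h1 (p s))
          rw [← lintegral_mul_const _ (by fun_prop)]
          refine lintegral_congr fun a => ?_
          simp only [F]
          ring
      _ ≤ ∫⁻ d, ∫⁻ y, g (Function.update d n (previous d n + y)) ∂τ n ∂departureLaw τ n :=
          ih (by omega) hG.lintegral_prod_right'
      _ = ∫⁻ d, g d ∂departureLaw τ (n + 1) := by
          rw [departureLaw, lintegral_map hg (measurable_departureStep n),
            lintegral_prod _ hG.aemeasurable]

end Queue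

namespace Queue

variable {m : TimeModel} {ν : Measure ℝ} [IsProbabilityMeasure ν]

/-! ### A bound of Fano type -/

/-- The log-likelihood ratio, for the first `n` packets, between the departures from the queue and
independent times between departures with the laws `τ i`. -/
def logRatio (m : TimeModel) (ν : Measure ℝ) (τ : ℕ → Measure ℝ) (f : ℕ → (ℕ → ℝ) → ℝ) (n : ℕ)
    (s : ℕ → ℝ) : ℝ :=
  ∑ i ∈ Finset.range n,
    (Real.log (m.density ν (s i)) - Real.log (m.density (τ i) (idle f s i + s i)))

theorem FeedbackCode.arrival_mem_grid {n M : ℕ} (c : FeedbackCode m n M) (u : Fin M) (s : ℕ → ℝ)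
    (hs : ∀ k, s k ∈ m.times) (i : ℕ) (hi : i < n) : arrival (c.enc u) s i ∈ m.grid :=
  (c.arrival_mem u s hs i hi).1

/-- The set of service times for which the message `u` is decoded correctly. -/
def FeedbackCode.success {n M : ℕ} (c : FeedbackCode m n M) (u : Fin M) : Set (ℕ → ℝ) :=
  {s | c.dec (fun i : Fin n => departure (c.enc u) s i) = u}

theorem FeedbackCode.measurableSet_success {n M : ℕ} (c : FeedbackCode m n M) (u : Fin M) :
    MeasurableSet (c.success u) := by
  have h : Measurable fun s : ℕ → ℝ => c.dec (fun i : Fin n => departure (c.enc u) s i) := by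
    refine c.measurable_dec.comp (measurable_pi_lambda _ fun i => ?_)
    exact (measurable_pi_apply (i : ℕ)).comp
      (measurable_history (c.measurable_enc u) (Nat.succ_le_of_lt i.2))
  exact h (measurableSet_singleton u)

/-- The record of departures is decoded as the first `n` departures. -/
theorem FeedbackCode.mem_success_iff {n M : ℕ} (c : FeedbackCode m n M) (u : Fin M) (s : ℕ → ℝ) :
    s ∈ c.success u ↔ c.dec (fun i : Fin n => history (c.enc u) s n i) = u := by
  have h : (fun i : Fin n => history (c.enc u) s n i)
      = fun i : Fin n => departure (c.enc u) s i := by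
    funext i
    exact history_apply _ _ i.2
  rw [h]
  rfl

/-- The exponential moment which replaces mutual information: if correct decoding is
rewarded by the factor `M`, the mean likelihood ratio is at most `2` after averaging over messages,
as the decoding regions are disjoint and have total mass one under the reference law. -/
theorem FeedbackCode.sum_lintegral_exp_le {n M : ℕ} (c : FeedbackCode m n M)
    (hν : TimeModel.IsService m ν) {τ : ℕ → Measure ℝ} [∀ i, IsProbabilityMeasure (τ i)]
    (hτ : ∀ i, τ i ≪ m.refMeasure)
    (hpos : ∀ u, ∀ i < n, ∀ᵐ s ∂iidLaw ν, 0 < m.density (τ i) (idle (c.enc u) s i + s i)) :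
    ∑ u, ∫⁻ s, ENNReal.ofReal (Real.exp ((c.success u).indicator (fun _ => Real.log M) s
        - logRatio m ν τ (c.enc u) n s)) ∂iidLaw ν ≤ 2 * M := by
  have hM : ∀ _ : Fin M, 0 < M := fun u => u.pos
  let A : Fin M → Set (ℕ → ℝ) := fun u => {d | c.dec (fun i : Fin n => d i) = u}
  have hA : ∀ u, MeasurableSet (A u) := fun u =>
    (c.measurable_dec.comp (by fun_prop : Measurable fun (d : ℕ → ℝ) (i : Fin n) => d i))
      (measurableSet_singleton u)
  let g : Fin M → (ℕ → ℝ) → ENNReal := fun u d => 1 + (A u).indicator (fun _ => (M : ENNReal)) d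
  have hg : ∀ u, Measurable (g u) := fun u => by
    have h : Measurable ((A u).indicator fun _ => (M : ENNReal)) :=
      measurable_const.indicator (hA u)
    exact measurable_const.add h
  have h1 : ∀ u, ∫⁻ s, ENNReal.ofReal (Real.exp ((c.success u).indicator (fun _ => Real.log M) s
        - logRatio m ν τ (c.enc u) n s)) ∂iidLaw ν ≤ ∫⁻ d, g u d ∂departureLaw τ n := by
    intro u
    refine le_trans ?_ (lintegral_history_mul_prod_le hν.mem_times hν.absolutelyContinuous hτ
      (c.measurable_enc u) (c.arrival_mem_grid u) le_rfl (hg u))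
    refine lintegral_mono_ae ?_
    have hpos' : ∀ᵐ s ∂iidLaw ν, ∀ i < n, 0 < m.density (τ i) (idle (c.enc u) s i + s i) :=
      ae_all_iff.mpr fun i => by
        by_cases hi : i < n
        · filter_upwards [hpos u i hi] with s hs _ using hs
        · exact ae_of_all _ fun s h => absurd h hi
    filter_upwards [hpos', iidLaw_ae (TimeModel.density_pos hν.absolutelyContinuous)] with s h2 h3
    have h4 : Real.exp (-logRatio m ν τ (c.enc u) n s) = ∏ i ∈ Finset.range n,
        (m.density (τ i) (idle (c.enc u) s i + s i) / m.density ν (s i)) := by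
      rw [logRatio, ← Finset.sum_neg_distrib, Real.exp_sum]
      refine Finset.prod_congr rfl fun i hi => ?_
      rw [neg_sub, Real.exp_sub, Real.exp_log (h2 i (Finset.mem_range.mp hi)),
        Real.exp_log (h3 i)]
    rw [sub_eq_add_neg, Real.exp_add, ENNReal.ofReal_mul (Real.exp_nonneg _), h4,
      ENNReal.ofReal_prod_of_nonneg fun i hi => div_nonneg (TimeModel.density_nonneg _ _ _)
        (TimeModel.density_nonneg _ _ _)]
    refine mul_le_mul_left ?_ _
    by_cases hs : s ∈ c.success u
    · have hs' : history (c.enc u) s n ∈ A u := (c.mem_success_iff u s).mp hs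
      have : (0 : ℝ) < M := by exact_mod_cast hM u
      simp only [hs, Set.indicator_of_mem, Real.exp_log this, g, hs', ENNReal.ofReal_natCast]
      exact le_add_self
    · simp [hs, g]
  have h2 : ∀ u, ∫⁻ d, g u d ∂departureLaw τ n = 1 + M * departureLaw τ n (A u) := by
    intro u
    rw [lintegral_add_left measurable_const, lintegral_indicator_const (hA u)]
    simp
  have h3 : ∑ u, departureLaw τ n (A u) ≤ 1 := by
    rw [← measure_biUnion_finset (fun u _ v _ huv => ?_) fun u _ => hA u]
    · exact prob_le_one
    · refine Set.disjoint_left.mpr fun d hu hv => huv ?_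
      exact (hu : c.dec _ = u).symm.trans hv
  refine (Finset.sum_le_sum fun u _ => h1 u).trans ?_
  simp only [h2]
  rw [Finset.sum_add_distrib, ← Finset.mul_sum, two_mul]
  refine add_le_add (by simp) ?_
  simpa using mul_le_mul_right h3 (M : ENNReal)

/-- Fano's inequality, with the mutual information bounded by a mean log-likelihood ratio. -/
theorem FeedbackCode.log_card_le {n M : ℕ} (c : FeedbackCode m n M) {T ε : ℝ}
    (hc : c.Meets ν T ε)
    (hν : TimeModel.IsService m ν) {τ : ℕ → Measure ℝ} [∀ i, IsProbabilityMeasure (τ i)]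
    (hτ : ∀ i, τ i ≪ m.refMeasure)
    (hpos : ∀ u, ∀ i < n, ∀ᵐ s ∂iidLaw ν, 0 < m.density (τ i) (idle (c.enc u) s i + s i))
    (hint : ∀ u, Integrable (logRatio m ν τ (c.enc u) n) (iidLaw ν)) :
    (1 - ε) * Real.log M
      ≤ (∑ u, ∫ s, logRatio m ν τ (c.enc u) n s ∂iidLaw ν) / M + Real.log 2 := by
  have hM0 : 0 < M := (c.dec fun _ => 0).pos
  have hM : (0 : ℝ) < M := by exact_mod_cast hM0
  have hlogM : 0 ≤ Real.log M := Real.log_natCast_nonneg M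
  let φ : Fin M → (ℕ → ℝ) → ℝ := fun u s =>
    (c.success u).indicator (fun _ => Real.log M) s - logRatio m ν τ (c.enc u) n s
  have hind : ∀ u, Integrable ((c.success u).indicator fun _ => Real.log M) (iidLaw ν) :=
    fun u => (integrable_const _).indicator (c.measurableSet_success u)
  have hφ : ∀ u, Integrable (φ u) (iidLaw ν) := fun u => (hind u).sub (hint u)
  have hexp := c.sum_lintegral_exp_le hν hτ hpos
  have hfin : ∀ u, ∫⁻ s, ENNReal.ofReal (Real.exp (φ u s)) ∂iidLaw ν ≠ ⊤ := by
    intro u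
    refine ne_top_of_le_ne_top ?_ ((Finset.single_le_sum (fun _ _ => zero_le)
      (Finset.mem_univ u)).trans hexp)
    finiteness
  have hiexp : ∀ u, Integrable (fun s => Real.exp (φ u s)) (iidLaw ν) := fun u =>
    ⟨Real.continuous_exp.comp_aestronglyMeasurable (hφ u).1,
      (hasFiniteIntegral_iff_ofReal (ae_of_all _ fun s => Real.exp_nonneg _)).mpr
        (hfin u).lt_top⟩
  have hsum : ∑ u, ∫ s, Real.exp (φ u s) ∂iidLaw ν ≤ 2 * M := by
    have h1 : ∀ u, ∫ s, Real.exp (φ u s) ∂iidLaw ν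
        = (∫⁻ s, ENNReal.ofReal (Real.exp (φ u s)) ∂iidLaw ν).toReal := fun u =>
      integral_eq_lintegral_of_nonneg_ae (ae_of_all _ fun s => Real.exp_nonneg _) (hiexp u).1
    simp only [h1]
    rw [← ENNReal.toReal_sum fun u _ => hfin u]
    exact (ENNReal.toReal_mono (by finiteness) hexp).trans_eq (by simp)
  -- The tangent of the exponential at `log 2`.
  have htan : ∀ u, ∫ s, φ u s ∂iidLaw ν
      ≤ Real.log 2 - 1 + (∫ s, Real.exp (φ u s) ∂iidLaw ν) / 2 := by
    intro u
    have h1 : ∫ s, φ u s ∂iidLaw ν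
        ≤ ∫ s, (Real.log 2 - 1 + Real.exp (φ u s) / 2) ∂iidLaw ν := by
      refine integral_mono (hφ u) ((integrable_const _).add ((hiexp u).div_const 2)) fun s => ?_
      have h2 := Real.add_one_le_exp (φ u s - Real.log 2)
      rw [Real.exp_sub, Real.exp_log (by norm_num)] at h2
      linarith
    rwa [integral_add (integrable_const _) ((hiexp u).div_const 2), integral_div,
      integral_const, probReal_univ, one_smul] at h1
  have hφint : ∀ u, ∫ s, φ u s ∂iidLaw ν = Real.log M * (iidLaw ν).real (c.success u)
      - ∫ s, logRatio m ν τ (c.enc u) n s ∂iidLaw ν := by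
    intro u
    rw [integral_sub (hind u) (hint u), integral_indicator_const _ (c.measurableSet_success u),
      smul_eq_mul, mul_comm]
  have herr : ∀ u, (iidLaw ν).real
      {s | c.dec (fun i : Fin n => departure (c.enc u) s i) ≠ u}
        = 1 - (iidLaw ν).real (c.success u) := fun u =>
    probReal_compl_eq_one_sub (c.measurableSet_success u)
  have hε := hc.2
  simp only [herr] at hε
  rw [div_le_iff₀ hM, Finset.sum_sub_distrib] at hε
  have h1 := Finset.sum_le_sum fun u (_ : u ∈ Finset.univ) => htan u
  simp only [hφint] at h1
  rw [Finset.sum_sub_distrib, ← Finset.mul_sum, Finset.sum_add_distrib, ← Finset.sum_div] at h1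
  simp only [Finset.sum_const, Finset.card_univ, Fintype.card_fin, nsmul_eq_mul, mul_one] at h1 hε
  have h2 : (1 - ε) * M ≤ ∑ u, (iidLaw ν).real (c.success u) := by linarith
  have h3 := mul_le_mul_of_nonneg_left h2 hlogM
  rw [← sub_le_iff_le_add, le_div_iff₀ hM]
  nlinarith

end Queue

/-! ### A heavy-tailed reference law -/

namespace TimeModel

/-- Total mass of `(1 + x²)⁻¹` for the reference measure. -/
def heavyMass (m : TimeModel) : ℝ := (∫⁻ x, ENNReal.ofReal (1 + x ^ 2)⁻¹ ∂m.refMeasure).toReal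

theorem heavyMass_pos (m : TimeModel) : 0 < m.heavyMass := by
  refine ENNReal.toReal_pos ?_ m.lintegral_inv_one_add_sq_lt_top.ne
  rw [Ne, lintegral_eq_zero_iff (by fun_prop)]
  intro h
  have h1 : m.refMeasure Set.univ = 0 := by
    refine measure_mono_null (fun x _ => ?_) (ae_iff.mp h)
    have : 0 < (1 + x ^ 2)⁻¹ := by positivity
    simpa using this
  cases m with
  | continuous => simp [refMeasure] at h1
  | discrete =>
    rw [← lintegral_one, lintegral_refMeasure_discrete] at h1
    simp at h1

/-- The law with density proportional to `(1 + x²)⁻¹`: the relative entropy of a law to it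
grows only logarithmically with the mean. -/
def heavyLaw (m : TimeModel) : Measure ℝ :=
  m.refMeasure.withDensity fun x => ENNReal.ofReal ((1 + x ^ 2)⁻¹ / m.heavyMass)

instance (m : TimeModel) : IsProbabilityMeasure m.heavyLaw := by
  constructor
  have h := m.heavyMass_pos
  rw [heavyLaw, withDensity_apply _ MeasurableSet.univ, Measure.restrict_univ]
  simp only [div_eq_inv_mul, ENNReal.ofReal_mul (inv_nonneg.mpr h.le)]
  rw [lintegral_const_mul _ (by fun_prop),
    ← ENNReal.ofReal_toReal m.lintegral_inv_one_add_sq_lt_top.ne,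
    ← ENNReal.ofReal_mul (inv_nonneg.mpr h.le)]
  change ENNReal.ofReal (m.heavyMass⁻¹ * m.heavyMass) = 1
  rw [inv_mul_cancel₀ h.ne', ENNReal.ofReal_one]

theorem heavyLaw_absolutelyContinuous (m : TimeModel) : m.heavyLaw ≪ m.refMeasure :=
  withDensity_absolutelyContinuous _ _

theorem density_heavyLaw (m : TimeModel) :
    ∀ᵐ x ∂m.refMeasure, m.density m.heavyLaw x = (1 + x ^ 2)⁻¹ / m.heavyMass := by
  filter_upwards [Measure.rnDeriv_withDensity m.refMeasure
    (f := fun x => ENNReal.ofReal ((1 + x ^ 2)⁻¹ / m.heavyMass)) (by fun_prop)] with x hx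
  have h := m.heavyMass_pos
  rw [density, heavyLaw, hx, ENNReal.toReal_ofReal (by positivity)]

variable {m : TimeModel} {P ν : Measure ℝ}

theorem IsService.ae_add_density_heavyLaw (hν : IsService m ν) {w : ℝ} (hw : w ∈ m.grid) :
    ∀ᵐ s ∂ν, m.density m.heavyLaw (w + s) = (1 + (w + s) ^ 2)⁻¹ / m.heavyMass := by
  refine hν.absolutelyContinuous.ae_le ?_
  have h := m.density_heavyLaw
  rw [← m.map_add_refMeasure hw] at h
  exact ae_of_ae_map (by fun_prop) h

variable [IsProbabilityMeasure ν]

theorem IsService.log_density_heavyLaw {ν : Measure ℝ} (hν : IsService m ν) {w : ℝ} (hw : w ∈ m.grid) :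
    ∀ᵐ s ∂ν, Real.log (m.density m.heavyLaw (w + s))
      = -(Real.log (1 + (w + s) ^ 2) + Real.log m.heavyMass) := by
  filter_upwards [hν.ae_add_density_heavyLaw hw] with s hs
  rw [hs, Real.log_div (by positivity) m.heavyMass_pos.ne', Real.log_inv]
  ring

theorem IsService.integrable_log_heavyLaw (hν : IsService m ν) {w : ℝ} (hw : w ∈ m.times) :
    Integrable (fun s => Real.log (m.density m.heavyLaw (w + s))) ν := by
  have h1 : Integrable (fun s => Real.log (1 + (w + s) ^ 2)) ν := by
    have h2 : Integrable (fun s => 2 * (w + s)) ν :=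
      ((integrable_const w).add hν.integrable).const_mul 2
    refine h2.mono' (by fun_prop : Measurable fun s : ℝ =>
      Real.log (1 + (w + s) ^ 2)).aestronglyMeasurable ?_
    filter_upwards [hν.mem_times] with s hs
    have h3 : 0 ≤ w + s := add_nonneg hw.2 hs.2
    rw [Real.norm_of_nonneg (Real.log_nonneg (by nlinarith))]
    exact log_one_add_sq_le h3
  refine (h1.add (integrable_const (Real.log m.heavyMass))).neg.congr ?_
  filter_upwards [hν.log_density_heavyLaw hw.1] with s hs
  rw [hs]
  rfl

theorem IsService.neg_integral_log_heavyLaw_le (hν : IsService m ν) {w : ℝ} (hw : w ∈ m.times)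
    {T : ℝ} (hT : 0 < T) :
    -∫ s, Real.log (m.density m.heavyLaw (w + s)) ∂ν
      ≤ Real.log m.heavyMass + 2 * (Real.log T + (1 + (w + ∫ s, s ∂ν)) / T) := by
  have h2 : (fun s => Real.log m.heavyMass + 2 * (Real.log T + (1 + (w + s)) / T))
      = fun s => (Real.log m.heavyMass + 2 * (Real.log T + (1 + w) / T)) + 2 / T * s := by
    funext s
    ring
  have h3 : Integrable (fun s => Real.log m.heavyMass
      + 2 * (Real.log T + (1 + (w + s)) / T)) ν := by
    rw [h2]
    exact (integrable_const _).add (hν.integrable.const_mul _)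
  have h4 : ∫ s, (Real.log m.heavyMass + 2 * (Real.log T + (1 + (w + s)) / T)) ∂ν
      = Real.log m.heavyMass + 2 * (Real.log T + (1 + (w + ∫ s, s ∂ν)) / T) := by
    rw [h2, integral_add (integrable_const _) (hν.integrable.const_mul _), integral_const_mul,
      integral_const, probReal_univ, one_smul]
    ring
  rw [← integral_neg, ← h4]
  refine integral_mono_ae (hν.integrable_log_heavyLaw hw).neg h3 ?_
  filter_upwards [hν.log_density_heavyLaw hw.1, hν.mem_times] with s hs hs'
  have h5 : 0 ≤ w + s := add_nonneg hw.2 hs'.2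
  have h6 : Real.log (1 + (w + s) ^ 2) ≤ 2 * Real.log (1 + (w + s)) := by
    rw [← Real.log_rpow (by linarith)]
    refine Real.log_le_log (by positivity) ?_
    norm_num
    nlinarith
  have h7 := Real.log_le_sub_one_of_pos (by positivity : 0 < (1 + (w + s)) / T)
  rw [Real.log_div (by linarith) hT.ne'] at h7
  simp only [hs, neg_neg]
  linarith

/-- Gibbs' inequality. -/
theorem IsService.integral_log_density_le (hν : IsService m ν) {τ : Measure ℝ}
    [IsProbabilityMeasure τ] (hτ : τ ≪ m.refMeasure) (hντ : ν ≪ τ)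
    (hint : Integrable (fun s => Real.log (m.density τ s)) ν) :
    ∫ s, Real.log (m.density τ s) ∂ν ≤ ∫ s, Real.log (m.density ν s) ∂ν := by
  have h1 := lintegral_shift_mul_density_div_le hτ hν.absolutelyContinuous m.zero_mem_grid
    (g := fun _ => 1) measurable_const
  simp only [one_mul, zero_add, lintegral_const, measure_univ, mul_one] at h1
  have hnn : ∀ s, 0 ≤ m.density τ s / m.density ν s := fun s =>
    div_nonneg (m.density_nonneg _ _) (m.density_nonneg _ _)
  have h2 : Integrable (fun s => m.density τ s / m.density ν s) ν :=
    ⟨(by fun_prop : Measurable fun s => m.density τ s / m.density ν s).aestronglyMeasurable,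
      (hasFiniteIntegral_iff_ofReal (ae_of_all _ hnn)).mpr (h1.trans_lt ENNReal.one_lt_top)⟩
  have h3 : ∫ s, m.density τ s / m.density ν s ∂ν ≤ 1 := by
    rw [integral_eq_lintegral_of_nonneg_ae (ae_of_all _ hnn) h2.1]
    exact ENNReal.toReal_le_of_le_ofReal zero_le_one (by simpa using h1)
  have h4 : ∫ s, (Real.log (m.density τ s) - Real.log (m.density ν s)) ∂ν
      ≤ ∫ s, (m.density τ s / m.density ν s - 1) ∂ν := by
    refine integral_mono_ae (hint.sub hν.integrable_log) (h2.sub (integrable_const 1)) ?_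
    filter_upwards [density_pos hν.absolutelyContinuous, hντ.ae_le (density_pos hτ)] with s h5 h6
    have h7 := Real.log_le_sub_one_of_pos (div_pos h6 h5)
    rwa [Real.log_div h6.ne' h5.ne'] at h7
  rw [integral_sub hint hν.integrable_log, integral_sub h2 (integrable_const 1)] at h4
  simp only [integral_const, probReal_univ, one_smul] at h4
  linarith

/-! ### Idle times without feedback -/

/-- The law of `(X - S)⁺`, where `X` of law `P` and `S` of law `ν` are independent. -/
def idleLaw (P ν : Measure ℝ) : Measure ℝ := (P.prod ν).map (fun z : ℝ × ℝ => max (z.1 - z.2) 0)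

theorem lintegral_idleLaw {g : ℝ → ENNReal} (hg : Measurable g) :
    ∫⁻ w, g w ∂idleLaw P ν = ∫⁻ x, ∫⁻ a, g (max (x - a) 0) ∂ν ∂P := by
  rw [idleLaw, lintegral_map hg (by fun_prop), lintegral_prod _ (by fun_prop)]

variable [IsProbabilityMeasure P]

instance : IsProbabilityMeasure (idleLaw P ν) :=
  Measure.isProbabilityMeasure_map (by fun_prop)

theorem lintegral_addLaw_idleLaw {g : ℝ → ENNReal} (hg : Measurable g) :
    ∫⁻ w, g w ∂addLaw (idleLaw P ν) ν
      = ∫⁻ x, ∫⁻ a, ∫⁻ b, g (max (x - a) 0 + b) ∂ν ∂ν ∂P := by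
  have h : Measurable fun w => ∫⁻ b, g (w + b) ∂ν :=
    Measurable.lintegral_prod_right' (f := fun z : ℝ × ℝ => g (z.1 + z.2)) (by fun_prop)
  rw [lintegral_addLaw hg, lintegral_idleLaw h]

theorem map_delayed_eq_addLaw :
    (P.prod (ν.prod ν)).map (fun z : ℝ × ℝ × ℝ => max (z.1 - z.2.1) 0 + z.2.2)
      = addLaw (idleLaw P ν) ν := by
  refine Measure.ext_of_lintegral _ fun g hg => ?_
  rw [lintegral_addLaw_idleLaw hg, lintegral_map hg (by fun_prop), lintegral_prod _ (by fun_prop)]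
  refine lintegral_congr fun x => ?_
  rw [lintegral_prod _ (by fun_prop)]

theorem idleLaw_mem_times {P ν : Measure ℝ} (hP : ∀ᵐ x ∂P, x ∈ m.grid) (hν : ∀ᵐ s ∂ν, s ∈ m.times) :
    ∀ᵐ w ∂idleLaw P ν, w ∈ m.times := by
  refine (ae_map_iff (p := fun x => x ∈ m.times) (by fun_prop) m.measurableSet_times).mpr ?_
  filter_upwards [Measure.quasiMeasurePreserving_fst.ae hP,
    Measure.quasiMeasurePreserving_snd.ae hν] with z h1 h2
  exact ⟨m.max_mem_grid (m.sub_mem_grid h1 h2.1) m.zero_mem_grid, le_max_right _ _⟩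

theorem entropy_le_maxEntropyDelayed {a : ℝ} (hP : ∀ᵐ x ∂P, x ∈ m.grid)
    (ha : ∫⁻ w, ENNReal.ofReal w ∂idleLaw P ν ≤ ENNReal.ofReal a) :
    m.entropy (addLaw (idleLaw P ν) ν) ≤ m.maxEntropyDelayed ν a := by
  rw [← map_delayed_eq_addLaw]
  refine le_iSup₂ (f := fun (P : Measure ℝ) _ => m.entropy ((P.prod (ν.prod ν)).map
    (fun z : ℝ × ℝ × ℝ => max (z.1 - z.2.1) 0 + z.2.2))) P ⟨inferInstance, hP, ?_⟩
  rwa [idleLaw, lintegral_map (by fun_prop) (by fun_prop)] at ha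

theorem lintegral_addLaw_idleLaw_dirac_zero (hν : ∀ᵐ s ∂ν, s ∈ m.times) (g : ℝ → ENNReal) :
    ∫⁻ a, ∫⁻ b, g (max (0 - a) 0 + b) ∂ν ∂ν = ∫⁻ b, g b ∂ν := by
  have h : ∀ᵐ a ∂ν, ∫⁻ b, g (max (0 - a) 0 + b) ∂ν = ∫⁻ b, g b ∂ν := by
    filter_upwards [hν] with a ha
    rw [max_eq_right (by linarith [ha.2])]
    simp
  rw [lintegral_congr_ae h]
  simp

/-- The choice `X = 0` shows that a delayed input can always achieve `H(S)`. -/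
theorem entropy_le_maxEntropyDelayed_self {a : ℝ} (hν : ∀ᵐ s ∂ν, s ∈ m.times) :
    m.entropy ν ≤ m.maxEntropyDelayed ν a := by
  have h1 : addLaw (idleLaw (Measure.dirac 0) ν) ν = ν := by
    refine Measure.ext_of_lintegral _ fun g hg => ?_
    have h : Measurable fun x : ℝ => ∫⁻ a, ∫⁻ b, g (max (x - a) 0 + b) ∂ν ∂ν := by
      refine Measurable.lintegral_prod_right' (f := fun z : ℝ × ℝ =>
        ∫⁻ b, g (max (z.1 - z.2) 0 + b) ∂ν) ?_
      exact Measurable.lintegral_prod_right' (f := fun z : (ℝ × ℝ) × ℝ =>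
        g (max (z.1.1 - z.1.2) 0 + z.2)) (by fun_prop)
    rw [lintegral_addLaw_idleLaw hg, lintegral_dirac' _ h,
      lintegral_addLaw_idleLaw_dirac_zero hν]
  conv_lhs => rw [← h1]
  refine entropy_le_maxEntropyDelayed ?_ ?_
  · exact (ae_dirac_iff (p := fun x => x ∈ m.grid) m.measurableSet_grid).mpr m.zero_mem_grid
  · have h : Measurable fun x : ℝ => ∫⁻ a, ENNReal.ofReal (max (x - a) 0) ∂ν :=
      Measurable.lintegral_prod_right' (f := fun z : ℝ × ℝ =>
        ENNReal.ofReal (max (z.1 - z.2) 0)) (by fun_prop)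
    rw [lintegral_idleLaw (by fun_prop), lintegral_dirac' _ h]
    refine le_of_eq_of_le ?_ zero_le
    refine (lintegral_eq_zero_iff' (by fun_prop)).mpr ?_
    filter_upwards [hν] with a ha
    rw [max_eq_right (by linarith [ha.2])]
    simp

end TimeModel

namespace Queue

/-- Arrival time of packet `i + 1` relative to the start of service of packet `i`. -/
def slack (f : ℕ → (ℕ → ℝ) → ℝ) (s : ℕ → ℝ) (i : ℕ) : ℝ := arrival f s (i + 1) - start f s i

theorem idle_succ (f : ℕ → (ℕ → ℝ) → ℝ) (s : ℕ → ℝ) (i : ℕ) :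
    idle f s (i + 1) = max (slack f s i - s i) 0 := by
  have h : previous (history f s (i + 1)) (i + 1) = start f s i + s i := departure_eq_start
  rw [idle, start, h, slack, ← max_sub_sub_right, sub_self, sub_sub]

section NoFeedback

variable {m : TimeModel} {ν : Measure ℝ} [IsProbabilityMeasure ν]
  {f : ℕ → (ℕ → ℝ) → ℝ} {N i : ℕ}

theorem measurable_slack (hf : ∀ j < N, Measurable (f j)) (hi : i + 1 < N) :
    Measurable fun s => slack f s i :=
  ((hf _ hi).comp (measurable_history hf hi.le)).sub (measurable_start hf (by omega))

/-- Without feedback, the slack of packet `i + 1` depends on the services before `i` only. -/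
theorem slack_congr (hno : ∀ i < N, ∀ d d' : ℕ → ℝ, f i d = f i d') (hi : i + 1 < N)
    {s s' : ℕ → ℝ} (h : ∀ k < i, s k = s' k) : slack f s i = slack f s' i := by
  rw [slack, slack, start_congr h, arrival, arrival, hno _ hi]

theorem lintegral_idle_add_eq (hf : ∀ j < N, Measurable (f j))
    (hno : ∀ i < N, ∀ d d' : ℕ → ℝ, f i d = f i d') (hi : i + 1 < N) {g : ℝ → ENNReal}
    (hg : Measurable g) :
    ∫⁻ s, g (idle f s (i + 1) + s (i + 1)) ∂iidLaw ν
      = ∫⁻ x, ∫⁻ a, ∫⁻ b, g (max (x - a) 0 + b) ∂ν ∂ν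
          ∂(iidLaw ν).map (fun s => slack f s i) := by
  have h : Measurable fun x : ℝ => ∫⁻ a, ∫⁻ b, g (max (x - a) 0 + b) ∂ν ∂ν := by
    refine Measurable.lintegral_prod_right' (f := fun z : ℝ × ℝ =>
      ∫⁻ b, g (max (z.1 - z.2) 0 + b) ∂ν) ?_
    exact Measurable.lintegral_prod_right' (f := fun z : (ℝ × ℝ) × ℝ =>
      g (max (z.1.1 - z.1.2) 0 + z.2)) (by fun_prop)
  rw [lintegral_map h (measurable_slack hf hi)]
  simp only [idle_succ]
  exact lintegral_past_next_two (F := fun x a b => g (max (x - a) 0 + b))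
    (measurable_slack hf hi) (fun s s' => slack_congr hno hi) (by fun_prop)

theorem lintegral_idle_eq (hf : ∀ j < N, Measurable (f j))
    (hno : ∀ i < N, ∀ d d' : ℕ → ℝ, f i d = f i d') (hi : i + 1 < N) {g : ℝ → ENNReal}
    (hg : Measurable g) :
    ∫⁻ s, g (idle f s (i + 1)) ∂iidLaw ν
      = ∫⁻ x, ∫⁻ a, g (max (x - a) 0) ∂ν ∂(iidLaw ν).map (fun s => slack f s i) := by
  have h : Measurable fun x : ℝ => ∫⁻ a, g (max (x - a) 0) ∂ν :=
    Measurable.lintegral_prod_right' (f := fun z : ℝ × ℝ => g (max (z.1 - z.2) 0)) (by fun_prop)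
  rw [lintegral_map h (measurable_slack hf hi)]
  simp only [idle_succ]
  exact lintegral_past_next (F := fun x a => g (max (x - a) 0))
    (measurable_slack hf hi) (fun s s' => slack_congr hno hi) (by fun_prop)

end NoFeedback

end Queue

namespace Queue

/-! ### The converse bound without feedback -/

namespace FeedbackCode

variable {m : TimeModel} {ν : Measure ℝ} [IsProbabilityMeasure ν] {n M : ℕ}

theorem card_pos (c : FeedbackCode m n M) : 0 < M := (c.dec fun _ => 0).pos

theorem inv_card_mul_card (c : FeedbackCode m n M) : (M : ENNReal)⁻¹ * M = 1 :=
  ENNReal.inv_mul_cancel (by exact_mod_cast c.card_pos.ne') (by simp)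

/-- The law of the slack of a packet chosen at random, for a message chosen at random, where for
one packet out of `n + 1` the slack is replaced by `0`. That replacement
compensates for the first packet, whose idle time is not of the form `(X - S)⁺`. -/
def slackLaw (c : FeedbackCode m (n + 1) M) (ν : Measure ℝ) [IsProbabilityMeasure ν] :
    Measure ℝ :=
  ((n : ENNReal) + 1)⁻¹ • (Measure.dirac 0 + (M : ENNReal)⁻¹ •
    ∑ u, ∑ i ∈ Finset.range n, (iidLaw ν).map (fun s => slack (c.enc u) s i))

variable (c : FeedbackCode m (n + 1) M)

theorem lintegral_slackLaw {g : ℝ → ENNReal} (hg : Measurable g) :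
    ∫⁻ x, g x ∂c.slackLaw ν = ((n : ENNReal) + 1)⁻¹ * (g 0 + (M : ENNReal)⁻¹ *
      ∑ u, ∑ i ∈ Finset.range n, ∫⁻ x, g x ∂(iidLaw ν).map (fun s => slack (c.enc u) s i)) := by
  rw [slackLaw, lintegral_smul_measure, lintegral_add_measure, lintegral_dirac' _ hg,
    lintegral_smul_measure, lintegral_finsetSum_measure]
  simp only [lintegral_finsetSum_measure, smul_eq_mul]

theorem inv_succ_mul_succ (n : ℕ) : ((n : ENNReal) + 1)⁻¹ * (n + 1) = 1 :=
  ENNReal.inv_mul_cancel (by simp) (by finiteness)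

instance : IsProbabilityMeasure (c.slackLaw ν) := by
  constructor
  have h : ∀ u, ∀ i ∈ Finset.range n,
      ((iidLaw ν).map (fun s => slack (c.enc u) s i)) Set.univ = 1 := by
    intro u i hi
    have hi' := Finset.mem_range.mp hi
    have := Measure.isProbabilityMeasure_map (μ := iidLaw ν)
      (measurable_slack (c.measurable_enc u) (i := i) (by omega)).aemeasurable
    exact measure_univ
  rw [← lintegral_one, c.lintegral_slackLaw (g := fun _ => 1) measurable_const]
  simp only [lintegral_one]
  rw [Finset.sum_congr rfl fun u _ => Finset.sum_congr rfl (h u)]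
  simp only [Finset.sum_const, Finset.card_range, Finset.card_univ, Fintype.card_fin,
    nsmul_eq_mul, mul_one]
  rw [← mul_assoc, c.inv_card_mul_card, one_mul, add_comm 1 (n : ENNReal), inv_succ_mul_succ]

theorem slackLaw_mem_grid (hν : ∀ᵐ s ∂ν, s ∈ m.times) : ∀ᵐ x ∂c.slackLaw ν, x ∈ m.grid := by
  have hg := m.measurableSet_grid.compl
  change c.slackLaw ν m.gridᶜ = 0
  rw [← lintegral_indicator_one hg, c.lintegral_slackLaw (measurable_one.indicator hg)]
  have h : ∀ u, ∀ i ∈ Finset.range n, ∫⁻ x, m.gridᶜ.indicator 1 x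
      ∂(iidLaw ν).map (fun s => slack (c.enc u) s i) = 0 := by
    intro u i hi
    have hi' := Finset.mem_range.mp hi
    rw [lintegral_indicator_one hg, Measure.map_apply
      (measurable_slack (c.measurable_enc u) (by omega)) hg]
    change ∀ᵐ s ∂iidLaw ν, slack (c.enc u) s i ∈ m.grid
    filter_upwards [iidLaw_ae hν] with s hs
    exact m.sub_mem_grid (c.arrival_mem_grid u s hs _ (by omega))
      (start_mem_grid hs (c.arrival_mem_grid u s hs) (by omega))
  rw [Finset.sum_congr rfl fun u _ => Finset.sum_congr rfl (h u)]
  simp [m.zero_mem_grid]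

/-- The law of the time between departures that goes with `slackLaw`. -/
abbrev gapLaw (c : FeedbackCode m (n + 1) M) (ν : Measure ℝ) [IsProbabilityMeasure ν] :
    Measure ℝ :=
  TimeModel.addLaw (TimeModel.idleLaw (c.slackLaw ν) ν) ν

variable {c}

theorem WithoutFeedback.lintegral_idleLaw (hno : c.WithoutFeedback)
    (hν : ∀ᵐ s ∂ν, s ∈ m.times) {g : ℝ → ENNReal} (hg : Measurable g) :
    ∫⁻ w, g w ∂TimeModel.idleLaw (c.slackLaw ν) ν = ((n : ENNReal) + 1)⁻¹ * (g 0 +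
      (M : ENNReal)⁻¹ * ∑ u, ∑ i ∈ Finset.range n,
        ∫⁻ s, g (idle (c.enc u) s (i + 1)) ∂iidLaw ν) := by
  have h : Measurable fun x : ℝ => ∫⁻ a, g (max (x - a) 0) ∂ν :=
    Measurable.lintegral_prod_right' (f := fun z : ℝ × ℝ => g (max (z.1 - z.2) 0)) (by fun_prop)
  have h0 : ∫⁻ a, g (max (0 - a) 0) ∂ν = g 0 := by
    have h1 : ∀ᵐ a ∂ν, g (max (0 - a) 0) = g 0 := by
      filter_upwards [hν] with a ha
      rw [max_eq_right (by linarith [ha.2])]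
    rw [lintegral_congr_ae h1]
    simp
  rw [TimeModel.lintegral_idleLaw hg, c.lintegral_slackLaw h, h0]
  congr 3
  refine Finset.sum_congr rfl fun u _ => Finset.sum_congr rfl fun i hi => ?_
  have hi' := Finset.mem_range.mp hi
  exact (lintegral_idle_eq (c.measurable_enc u) (hno u) (by omega) hg).symm

theorem WithoutFeedback.gapLaw_eq (hno : c.WithoutFeedback) (hν : ∀ᵐ s ∂ν, s ∈ m.times) :
    c.gapLaw ν = ((n : ENNReal) + 1)⁻¹ • (ν + (M : ENNReal)⁻¹ •
      ∑ u, ∑ i ∈ Finset.range n,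
        (iidLaw ν).map (fun s => idle (c.enc u) s (i + 1) + s (i + 1))) := by
  refine Measure.ext_of_lintegral _ fun g hg => ?_
  have h : Measurable fun x : ℝ => ∫⁻ a, ∫⁻ b, g (max (x - a) 0 + b) ∂ν ∂ν := by
    refine Measurable.lintegral_prod_right' (f := fun z : ℝ × ℝ =>
      ∫⁻ b, g (max (z.1 - z.2) 0 + b) ∂ν) ?_
    exact Measurable.lintegral_prod_right' (f := fun z : (ℝ × ℝ) × ℝ =>
      g (max (z.1.1 - z.1.2) 0 + z.2)) (by fun_prop)
  rw [gapLaw, TimeModel.lintegral_addLaw_idleLaw hg, c.lintegral_slackLaw h,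
    TimeModel.lintegral_addLaw_idleLaw_dirac_zero hν, lintegral_smul_measure,
    lintegral_add_measure, lintegral_smul_measure, lintegral_finsetSum_measure]
  simp only [lintegral_finsetSum_measure, smul_eq_mul]
  congr 3
  refine Finset.sum_congr rfl fun u _ => Finset.sum_congr rfl fun i hi => ?_
  have hi' := Finset.mem_range.mp hi
  rw [← lintegral_idle_add_eq (c.measurable_enc u) (hno u) (by omega) hg, lintegral_map hg]
  exact (measurable_idle (c.measurable_enc u) (by omega)).add (measurable_pi_apply _)

variable (c) in
/-- The constraint on the mean of the last departure, as a constraint on the idle times. -/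
theorem sum_lintegral_idle_le (hν : TimeModel.IsService m ν) {lam mu ε : ℝ} (hlam : 0 < lam)
    (hlt : lam < mu) (hmean : ∫ s, s ∂ν = 1 / mu)
    (hc : c.Meets ν ((n + 1 : ℕ) / lam) ε) :
    ∑ u, ∑ i ∈ Finset.range (n + 1), ∫⁻ s, ENNReal.ofReal (idle (c.enc u) s i) ∂iidLaw ν
      ≤ M * ((n + 1) * ENNReal.ofReal (1 / lam - 1 / mu)) := by
  have hmu : 0 < mu := hlam.trans hlt
  have hM0 : (M : ENNReal) ≠ 0 := by exact_mod_cast c.card_pos.ne'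
  have hserv : ∫⁻ s, ENNReal.ofReal s ∂ν = ENNReal.ofReal (1 / mu) := by
    rw [← hmean, ofReal_integral_eq_lintegral_ofReal hν.integrable
      (hν.mem_times.mono fun _ h => h.2)]
  have h1 : ∀ u, ∫⁻ s, ENNReal.ofReal (previous (departure (c.enc u) s) (n + 1)) ∂iidLaw ν
      = ∑ i ∈ Finset.range (n + 1), ∫⁻ s, ENNReal.ofReal (idle (c.enc u) s i) ∂iidLaw ν
        + (n + 1) * ENNReal.ofReal (1 / mu) := by
    intro u
    have hmeas : ∀ i ∈ Finset.range (n + 1), Measurable fun s =>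
        ENNReal.ofReal (idle (c.enc u) s i) + ENNReal.ofReal (s i) := fun i hi =>
      (measurable_idle (c.measurable_enc u) (Finset.mem_range.mp hi)).ennreal_ofReal.add
        (measurable_pi_apply i).ennreal_ofReal
    have h2 : ∀ᵐ s ∂iidLaw ν, ENNReal.ofReal (previous (departure (c.enc u) s) (n + 1))
        = ∑ i ∈ Finset.range (n + 1),
          (ENNReal.ofReal (idle (c.enc u) s i) + ENNReal.ofReal (s i)) := by
      filter_upwards [iidLaw_ae hν.mem_times] with s hs
      rw [previous_departure_eq_sum, ENNReal.ofReal_sum_of_nonneg fun i _ =>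
        add_nonneg idle_nonneg (hs i).2]
      exact Finset.sum_congr rfl fun i _ => ENNReal.ofReal_add idle_nonneg (hs i).2
    have h3 : ∀ i, ∫⁻ s, ENNReal.ofReal (s i) ∂iidLaw ν = ENNReal.ofReal (1 / mu) := by
      intro i
      rw [← hserv]
      exact (measurePreserving_eval_infinitePi (fun _ : ℕ => ν) i).lintegral_comp
        ENNReal.measurable_ofReal
    rw [lintegral_congr_ae h2, lintegral_finsetSum' _ fun i hi => (hmeas i hi).aemeasurable]
    have h4 : ∀ i ∈ Finset.range (n + 1), ∫⁻ s, (ENNReal.ofReal (idle (c.enc u) s i)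
        + ENNReal.ofReal (s i)) ∂iidLaw ν
        = ∫⁻ s, ENNReal.ofReal (idle (c.enc u) s i) ∂iidLaw ν + ENNReal.ofReal (1 / mu) := by
      intro i hi
      rw [lintegral_add_right _ (by fun_prop), h3]
    rw [Finset.sum_congr rfl h4, Finset.sum_add_distrib]
    simp
  have h5 := hc.1
  rw [ENNReal.div_le_iff hM0 (by simp)] at h5
  simp only [h1] at h5
  rw [Finset.sum_add_distrib] at h5
  have h6 : ENNReal.ofReal ((n + 1 : ℕ) / lam) * M
      = M * ((n + 1) * ENNReal.ofReal (1 / lam - 1 / mu))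
        + M * ((n + 1) * ENNReal.ofReal (1 / mu)) := by
    have h7 : 0 ≤ 1 / lam - 1 / mu := sub_nonneg.mpr (one_div_le_one_div_of_le hlam hlt.le)
    rw [← mul_add, ← mul_add, ← ENNReal.ofReal_add h7 (by positivity), sub_add_cancel,
      mul_comm, div_eq_mul_one_div, ENNReal.ofReal_mul (by positivity), ENNReal.ofReal_natCast]
    push_cast
    rfl
  rw [h6] at h5
  simp only [Finset.sum_const, Finset.card_univ, Fintype.card_fin, nsmul_eq_mul] at h5
  refine (ENNReal.add_le_add_iff_right ?_).mp h5
  finiteness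

theorem WithoutFeedback.lintegral_idleLaw_le (hno : c.WithoutFeedback)
    (hν : TimeModel.IsService m ν) {lam mu ε : ℝ} (hlam : 0 < lam)
    (hlt : lam < mu) (hmean : ∫ s, s ∂ν = 1 / mu)
    (hc : c.Meets ν ((n + 1 : ℕ) / lam) ε) :
    ∫⁻ w, ENNReal.ofReal w ∂TimeModel.idleLaw (c.slackLaw ν) ν
      ≤ ENNReal.ofReal (1 / lam - 1 / mu) := by
  rw [hno.lintegral_idleLaw hν.mem_times (by fun_prop), ENNReal.ofReal_zero, zero_add]
  have h1 : ∑ u, ∑ i ∈ Finset.range n, ∫⁻ s, ENNReal.ofReal (idle (c.enc u) s (i + 1)) ∂iidLaw ν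
      ≤ M * ((n + 1) * ENNReal.ofReal (1 / lam - 1 / mu)) := by
    refine le_trans (Finset.sum_le_sum fun u _ => ?_)
      (c.sum_lintegral_idle_le hν hlam hlt hmean hc)
    rw [Finset.sum_range_succ']
    exact le_self_add
  calc ((n : ENNReal) + 1)⁻¹ * ((M : ENNReal)⁻¹ * ∑ u, ∑ i ∈ Finset.range n,
        ∫⁻ s, ENNReal.ofReal (idle (c.enc u) s (i + 1)) ∂iidLaw ν)
      ≤ ((n : ENNReal) + 1)⁻¹ * ((M : ENNReal)⁻¹ *
        (M * ((n + 1) * ENNReal.ofReal (1 / lam - 1 / mu)))) := by gcongr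
    _ = ENNReal.ofReal (1 / lam - 1 / mu) := by
      rw [← mul_assoc (M : ENNReal)⁻¹, c.inv_card_mul_card, one_mul, ← mul_assoc,
        inv_succ_mul_succ, one_mul]

theorem WithoutFeedback.idle_zero (hno : c.WithoutFeedback) (u : Fin M) (s : ℕ → ℝ) :
    idle (c.enc u) s 0 = idle (c.enc u) (fun _ => 0) 0 := by
  rw [idle, idle, start, start, arrival, arrival, hno u 0 (by omega) (history (c.enc u) s 0)]
  rfl

theorem WithoutFeedback.sum_idle_zero_le (hno : c.WithoutFeedback)
    (hν : TimeModel.IsService m ν) {lam mu ε : ℝ} (hlam : 0 < lam)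
    (hlt : lam < mu) (hmean : ∫ s, s ∂ν = 1 / mu)
    (hc : c.Meets ν ((n + 1 : ℕ) / lam) ε) :
    ∑ u, idle (c.enc u) (fun _ => 0) 0 ≤ M * ((n + 1) * (1 / lam - 1 / mu)) := by
  have h7 : 0 ≤ 1 / lam - 1 / mu := sub_nonneg.mpr (one_div_le_one_div_of_le hlam hlt.le)
  have h := c.sum_lintegral_idle_le hν hlam hlt hmean hc
  rw [← ENNReal.ofReal_le_ofReal_iff (by positivity), ENNReal.ofReal_sum_of_nonneg
    fun _ _ => idle_nonneg, ENNReal.ofReal_mul (by positivity), ENNReal.ofReal_mul (by positivity),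
    ENNReal.ofReal_natCast, ENNReal.ofReal_add (by positivity) zero_le_one,
    ENNReal.ofReal_natCast, ENNReal.ofReal_one]
  refine le_trans (Finset.sum_le_sum fun u _ => ?_) h
  rw [Finset.sum_range_succ']
  refine le_trans (le_of_eq ?_) le_add_self
  simp only [hno.idle_zero u]
  simp

/-- For a code without feedback, `log M` is at most `n (H(τ) - H(S))` up to lower order terms, where
`τ` is a law of the form allowed in the definition of `maxEntropyDelayed`; here `-K` bounds the mean
of `log q` from below for the density `q` of every such law. -/
theorem WithoutFeedback.log_card_le (hno : c.WithoutFeedback)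
    (hν : TimeModel.IsService m ν) {lam mu ε K : ℝ} (hlam : 0 < lam)
    (hlt : lam < mu) (hmean : ∫ s, s ∂ν = 1 / mu)
    (hK : ∀ (P : Measure ℝ) [IsProbabilityMeasure P], (∀ᵐ x ∂P, x ∈ m.grid) →
      ∫⁻ w, ENNReal.ofReal w ∂TimeModel.idleLaw P ν ≤ ENNReal.ofReal (1 / lam - 1 / mu) →
      -∫ x, Real.log (m.density (TimeModel.addLaw (TimeModel.idleLaw P ν) ν) x)
        ∂TimeModel.addLaw (TimeModel.idleLaw P ν) ν ≤ K)
    (hc : c.Meets ν ((n + 1 : ℕ) / lam) ε) :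
    (1 - ε) * Real.log M ≤ (n + 1) * (K + ∫ x, Real.log (m.density ν x) ∂ν)
      + 2 * Real.log (n + 2) + (Real.log m.heavyMass + 2 * (1 / lam + 1)
        + Real.log 2 + ∫ x, Real.log (m.density ν x) ∂ν) := by
  have hM : (0 : ℝ) < M := by exact_mod_cast c.card_pos
  have h7 : 0 ≤ 1 / lam - 1 / mu := sub_nonneg.mpr (one_div_le_one_div_of_le hlam hlt.le)
  have hgrid := c.slackLaw_mem_grid hν.mem_times
  have hcost := hno.lintegral_idleLaw_le hν hlam hlt hmean hc
  have hidle := TimeModel.idleLaw_mem_times hgrid hν.mem_times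
  have hgap : TimeModel.IsService m (c.gapLaw ν) :=
    hν.addLaw hidle (TimeModel.integrable_of_lintegral_ofReal_le hidle hcost)
  have hKc := hK (c.slackLaw ν) hgrid hcost
  set q : ℝ → ℝ := fun x => Real.log (m.density (c.gapLaw ν) x) with hq
  set r : ℝ → ℝ := fun x => Real.log (m.density ν x) with hr
  have hgapeq := hno.gapLaw_eq hν.mem_times
  -- Integrals with respect to `gapLaw` split into integrals over its components.
  have hqint := hgap.integrable_log
  have hn0 : ((n : ENNReal) + 1)⁻¹ ≠ 0 := ENNReal.inv_ne_zero.mpr (by finiteness)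
  have hM1 : (M : ENNReal)⁻¹ ≠ 0 := ENNReal.inv_ne_zero.mpr (by finiteness)
  have hn1 : ((n : ENNReal) + 1)⁻¹ ≠ ⊤ := ENNReal.inv_ne_top.mpr (by simp)
  have hM2 : (M : ENNReal)⁻¹ ≠ ⊤ := ENNReal.inv_ne_top.mpr (by exact_mod_cast c.card_pos.ne')
  have hqint' : Integrable q (ν + (M : ENNReal)⁻¹ • ∑ u, ∑ i ∈ Finset.range n,
      (iidLaw ν).map (fun s => idle (c.enc u) s (i + 1) + s (i + 1))) := by
    have h1 := hqint
    nth_rw 2 [hgapeq] at h1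
    exact (integrable_smul_measure hn0 hn1).mp h1
  have hqν : Integrable q ν := hqint'.left_of_add_measure
  have hqsum := (integrable_smul_measure hM1 hM2).mp hqint'.right_of_add_measure
  have hmeasD : ∀ u, ∀ i < n + 1, Measurable fun s => idle (c.enc u) s i + s i :=
    fun u i hi => (measurable_idle (c.measurable_enc u) hi).add (measurable_pi_apply _)
  have hqD : ∀ u, ∀ i ∈ Finset.range n, Integrable q ((iidLaw ν).map
      (fun s => idle (c.enc u) s (i + 1) + s (i + 1))) := by
    intro u i hi
    rw [integrable_finsetSum_measure] at hqsum
    have h1 := hqsum u (Finset.mem_univ u)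
    rw [integrable_finsetSum_measure] at h1
    exact h1 i hi
  have hqD' : ∀ u, ∀ i ∈ Finset.range n, Integrable
      (fun s => q (idle (c.enc u) s (i + 1) + s (i + 1))) (iidLaw ν) := by
    intro u i hi
    have := Finset.mem_range.mp hi
    exact (hqD u i hi).comp_measurable (hmeasD u (i + 1) (by omega))
  have hsplit : (n + 1) * ∫ x, q x ∂c.gapLaw ν = ∫ x, q x ∂ν + (∑ u, ∑ i ∈ Finset.range n,
      ∫ s, q (idle (c.enc u) s (i + 1) + s (i + 1)) ∂iidLaw ν) / M := by
    have h1 : ∫ x, q x ∂c.gapLaw ν = ((n : ENNReal) + 1)⁻¹.toReal * (∫ x, q x ∂ν +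
        (M : ENNReal)⁻¹.toReal * ∑ u, ∑ i ∈ Finset.range n,
          ∫ s, q (idle (c.enc u) s (i + 1) + s (i + 1)) ∂iidLaw ν) := by
      conv_lhs => rw [hgapeq]
      rw [integral_smul_measure, integral_add_measure hqν hqint'.right_of_add_measure,
        integral_smul_measure, integral_finsetSum_measure fun u _ =>
          integrable_finsetSum_measure.mpr (hqD u)]
      rw [smul_eq_mul, smul_eq_mul]
      congr 3
      refine Finset.sum_congr rfl fun u _ => ?_
      rw [integral_finsetSum_measure (hqD u)]
      refine Finset.sum_congr rfl fun i hi => ?_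
      have := Finset.mem_range.mp hi
      exact integral_map (hmeasD u (i + 1) (by omega)).aemeasurable (hqD u i hi).1
    rw [h1, ENNReal.toReal_inv, ENNReal.toReal_inv, ENNReal.toReal_add (by simp) (by simp)]
    simp only [ENNReal.toReal_natCast, ENNReal.toReal_one]
    field_simp
  -- The reference law: heavy-tailed for the first departure, `gapLaw` for the other ones.
  let τ : ℕ → Measure ℝ := fun i => if i = 0 then m.heavyLaw else c.gapLaw ν
  have hτ0 : τ 0 = m.heavyLaw := rfl
  have hτs : ∀ i, τ (i + 1) = c.gapLaw ν := fun i => rfl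
  have hprob : ∀ i, IsProbabilityMeasure (τ i) := by
    intro i
    cases i with
    | zero => exact inferInstanceAs (IsProbabilityMeasure m.heavyLaw)
    | succ i => exact inferInstanceAs (IsProbabilityMeasure (c.gapLaw ν))
  have hτ : ∀ i, τ i ≪ m.refMeasure := by
    intro i
    cases i with
    | zero => exact m.heavyLaw_absolutelyContinuous
    | succ i => exact hgap.absolutelyContinuous
  let w : Fin M → ℝ := fun u => idle (c.enc u) (fun _ => 0) 0
  have hw : ∀ u, w u ∈ m.times := fun u =>
    idle_mem_times (fun _ => m.zero_mem_times) (c.arrival_mem_grid u _ fun _ => m.zero_mem_times)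
      (Nat.succ_pos n)
  have hw0 : ∀ u s, idle (c.enc u) s 0 = w u := hno.idle_zero
  have hpos : ∀ u, ∀ i < n + 1, ∀ᵐ s ∂iidLaw ν, 0 < m.density (τ i) (idle (c.enc u) s i + s i) := by
    intro u i hi
    cases i with
    | zero =>
      have h1 : ∀ᵐ s ∂ν, 0 < m.density m.heavyLaw (w u + s) := by
        filter_upwards [hν.ae_add_density_heavyLaw (hw u).1] with s hs
        have := m.heavyMass_pos
        rw [hs]
        positivity
      filter_upwards [iidLaw_ae h1] with s hs
      rw [hτ0, hw0]
      exact hs 0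
    | succ i =>
      rw [hτs]
      have h1 := TimeModel.density_pos hgap.absolutelyContinuous
      refine ae_of_ae_map (p := fun x => 0 < m.density (c.gapLaw ν) x)
        (hmeasD u (i + 1) hi).aemeasurable ?_
      have h2 : (iidLaw ν).map (fun s => idle (c.enc u) s (i + 1) + s (i + 1)) ≪ c.gapLaw ν := by
        rw [hgapeq]
        refine Measure.AbsolutelyContinuous.mk fun A hA h => ?_
        simp only [Measure.smul_apply, Measure.add_apply, smul_eq_mul, mul_eq_zero, hn0, hM1,
          false_or, add_eq_zero, Measure.finsetSum_apply, Finset.sum_eq_zero_iff] at h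
        exact h.2 u (Finset.mem_univ u) i (Finset.mem_range.mpr (by omega))
      exact h2.ae_le h1
  have hr_eq : ∀ i, ∫ s : ℕ → ℝ, r (s i) ∂iidLaw ν = ∫ x, r x ∂ν :=
    integral_eval_iidLaw hν.integrable_log
  have hi1 : ∀ u, ∀ i ∈ Finset.range n, Integrable
      (fun s => r (s (i + 1)) - q (idle (c.enc u) s (i + 1) + s (i + 1))) (iidLaw ν) :=
    fun u i hi => (integrable_eval_iidLaw hν.integrable_log (i + 1)).sub (hqD' u i hi)
  have h0_int : ∀ u, Integrable (fun s : ℕ → ℝ => Real.log (m.density m.heavyLaw (w u + s 0)))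
      (iidLaw ν) := fun u => integrable_eval_iidLaw (hν.integrable_log_heavyLaw (hw u)) 0
  have h0_eq : ∀ u, ∫ s : ℕ → ℝ, Real.log (m.density m.heavyLaw (w u + s 0)) ∂iidLaw ν
      = ∫ x, Real.log (m.density m.heavyLaw (w u + x)) ∂ν := fun u =>
    integral_eval_iidLaw (hν.integrable_log_heavyLaw (hw u)) 0
  have hi0 : ∀ u, Integrable (fun s : ℕ → ℝ =>
      r (s 0) - Real.log (m.density m.heavyLaw (w u + s 0))) (iidLaw ν) :=
    fun u => (integrable_eval_iidLaw hν.integrable_log 0).sub (h0_int u)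
  have hL : ∀ u, logRatio m ν τ (c.enc u) (n + 1) = fun s =>
      ∑ i ∈ Finset.range n, (r (s (i + 1)) - q (idle (c.enc u) s (i + 1) + s (i + 1)))
        + (r (s 0) - Real.log (m.density m.heavyLaw (w u + s 0))) := by
    intro u
    funext s
    rw [logRatio, Finset.sum_range_succ', hτ0, hw0]
    rfl
  have hint : ∀ u, Integrable (logRatio m ν τ (c.enc u) (n + 1)) (iidLaw ν) := by
    intro u
    rw [hL]
    exact (integrable_finsetSum _ (hi1 u)).add (hi0 u)
  have hLint : ∀ u, ∫ s, logRatio m ν τ (c.enc u) (n + 1) s ∂iidLaw ν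
      = (n + 1) * ∫ x, r x ∂ν
        - ∑ i ∈ Finset.range n, ∫ s, q (idle (c.enc u) s (i + 1) + s (i + 1)) ∂iidLaw ν
        + -∫ x, Real.log (m.density m.heavyLaw (w u + x)) ∂ν := by
    intro u
    have h1 : ∀ i ∈ Finset.range n,
        ∫ s, (r (s (i + 1)) - q (idle (c.enc u) s (i + 1) + s (i + 1))) ∂iidLaw ν
          = ∫ x, r x ∂ν - ∫ s, q (idle (c.enc u) s (i + 1) + s (i + 1)) ∂iidLaw ν :=
      fun i hi => (integral_sub (integrable_eval_iidLaw hν.integrable_log (i + 1))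
        (hqD' u i hi)).trans (congrArg (· - _) (hr_eq (i + 1)))
    have h2 : ∫ s, (r (s 0) - Real.log (m.density m.heavyLaw (w u + s 0))) ∂iidLaw ν
        = ∫ x, r x ∂ν - ∫ x, Real.log (m.density m.heavyLaw (w u + x)) ∂ν :=
      (integral_sub (integrable_eval_iidLaw hν.integrable_log 0) (h0_int u)).trans
        (congrArg₂ (· - ·) (hr_eq 0) (h0_eq u))
    rw [hL u, integral_add (integrable_finsetSum _ (hi1 u)) (hi0 u),
      integral_finsetSum _ (hi1 u), Finset.sum_congr rfl h1, h2, Finset.sum_sub_distrib,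
      Finset.sum_const, Finset.card_range, nsmul_eq_mul]
    ring
  have hfano := c.log_card_le hc hν hτ hpos hint
  simp only [hLint] at hfano
  rw [Finset.sum_add_distrib, Finset.sum_sub_distrib] at hfano
  simp only [Finset.sum_const, Finset.card_univ, Fintype.card_fin, nsmul_eq_mul] at hfano
  have hgibbs : ∫ x, q x ∂ν ≤ ∫ x, r x ∂ν := by
    refine hν.integral_log_density_le hgap.absolutelyContinuous ?_ hqν
    rw [hgapeq]
    refine Measure.AbsolutelyContinuous.mk fun A hA h => ?_
    simp only [Measure.smul_apply, Measure.add_apply, smul_eq_mul, mul_eq_zero, hn0,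
      false_or, add_eq_zero] at h
    exact h.1
  have hT : (0 : ℝ) < n + 2 := by positivity
  have hfirst : (∑ u, -∫ x, Real.log (m.density m.heavyLaw (w u + x)) ∂ν) / M
      ≤ Real.log m.heavyMass + 2 * (Real.log (n + 2) + (1 / lam + 1)) := by
    rw [div_le_iff₀ hM]
    refine (Finset.sum_le_sum fun u _ => hν.neg_integral_log_heavyLaw_le (hw u) hT).trans ?_
    have h1 := hno.sum_idle_zero_le hν hlam hlt hmean hc
    have h2 : ∀ u, Real.log m.heavyMass + 2 * (Real.log (n + 2) + (1 + (w u + ∫ s, s ∂ν)) / (n + 2))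
        = (Real.log m.heavyMass + 2 * (Real.log (n + 2) + (1 + 1 / mu) / (n + 2)))
          + 2 / (n + 2) * w u := by
      intro u
      rw [hmean]
      ring
    simp only [h2]
    rw [Finset.sum_add_distrib, ← Finset.mul_sum]
    simp only [Finset.sum_const, Finset.card_univ, Fintype.card_fin, nsmul_eq_mul]
    have h3 : 2 / ((n : ℝ) + 2) * ∑ u, w u
        ≤ 2 / ((n : ℝ) + 2) * (M * ((n + 1) * (1 / lam - 1 / mu))) := by gcongr
    have h4 : (1 + 1 / mu) / ((n : ℝ) + 2) + 1 / (n + 2) * ((n + 1) * (1 / lam - 1 / mu))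
        ≤ 1 / lam + 1 := by
      have hmu : 0 < 1 / mu := one_div_pos.mpr (hlam.trans hlt)
      rw [div_add' _ _ _ hT.ne', div_le_iff₀ hT]
      have h5 : 1 / ((n : ℝ) + 2) * ((n + 1) * (1 / lam - 1 / mu)) * (n + 2)
          = (n + 1) * (1 / lam - 1 / mu) := by field_simp
      rw [h5]
      have hn : (0 : ℝ) ≤ n := n.cast_nonneg
      nlinarith [mul_nonneg hn hmu.le, mul_nonneg hn h7]
    have h6 := mul_le_mul_of_nonneg_left h4 (by positivity : 0 ≤ 2 * (M : ℝ))
    calc _ ≤ _ := add_le_add_right h3 _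
      _ = M * (Real.log m.heavyMass + 2 * Real.log (n + 2)) + 2 * (M : ℝ) *
          ((1 + 1 / mu) / ((n : ℝ) + 2) + 1 / (n + 2) * ((n + 1) * (1 / lam - 1 / mu))) := by ring
      _ ≤ M * (Real.log m.heavyMass + 2 * Real.log (n + 2)) + 2 * (M : ℝ) * (1 / lam + 1) := by
          gcongr
      _ = _ := by ring
  rw [add_div, sub_div, mul_div_cancel_left₀ _ hM.ne'] at hfano
  have hn1' : (0 : ℝ) < n + 1 := by positivity
  have h8 := mul_le_mul_of_nonneg_left hKc hn1'.le
  linarith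

end FeedbackCode

end Queue

/-! ### Feinstein's lemma for additive memoryless noise -/

/-- Feinstein's lemma: a maximal family of inputs `w 0, w 1, …` in `F` whose decoding regions
`G (w i)`, less the earlier ones, have probability at least `c` cannot be too small, since the
probability of the union of its regions under the output law `Q` is at most `k * β`. -/
theorem exists_codewords {X Y : Type*} [MeasurableSpace X] [MeasurableSpace Y] [Nonempty X]
    (μ : Measure X) [IsProbabilityMeasure μ] (κ : X → Measure Y) (Q : Measure Y) (G : X → Set Y)
    (F : Set X) {β c : ENNReal} {k : ℕ} (hF : MeasurableSet F)
    (hG : ∀ x, MeasurableSet (G x))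
    (hQ : ∀ B, MeasurableSet B → ∫⁻ x, κ x B ∂μ ≤ Q B) (hβ : ∀ x ∈ F, Q (G x) ≤ β)
    (hc : c + k * β < ∫⁻ x in F, κ x (G x) ∂μ) :
    ∃ w : ℕ → X, ∀ i < k, w i ∈ F ∧ c ≤ κ (w i) (G (w i) \ ⋃ j ∈ Finset.range i, G (w j)) := by
  induction k with
  | zero => exact ⟨fun _ => Classical.arbitrary X, fun i hi => absurd hi (Nat.not_lt_zero i)⟩
  | succ k ih =>
    have hk : c + k * β ≤ c + (k + 1 : ℕ) * β := by gcongr; omega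
    obtain ⟨w, hw⟩ := ih (hk.trans_lt hc)
    let B : Set Y := ⋃ j ∈ Finset.range k, G (w j)
    have hB : MeasurableSet B := Finset.measurableSet_biUnion _ fun j _ => hG _
    have hQB : Q B ≤ k * β := by
      refine (measure_biUnion_finset_le _ _).trans ((Finset.sum_le_sum fun j hj =>
        hβ _ (hw j (Finset.mem_range.mp hj)).1).trans ?_)
      simp
    obtain ⟨x, hxF, hx⟩ : ∃ x ∈ F, c ≤ κ x (G x \ B) := by
      by_contra! hcon
      refine absurd hc (not_lt.mpr ?_)
      calc ∫⁻ x in F, κ x (G x) ∂μ ≤ ∫⁻ x in F, (c + κ x B) ∂μ := by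
            refine setLIntegral_mono' hF fun x hx => ?_
            refine (measure_le_inter_add_sdiff (κ x) (G x) B).trans ?_
            rw [add_comm]
            exact add_le_add (hcon x hx).le (measure_mono Set.inter_subset_right)
        _ ≤ ∫⁻ x, (c + κ x B) ∂μ := setLIntegral_le_lintegral _ _
        _ = c + ∫⁻ x, κ x B ∂μ := by
            rw [lintegral_add_left measurable_const]
            simp
        _ ≤ c + (k + 1 : ℕ) * β := add_le_add_right ((hQ B hB).trans (hQB.trans (by
            gcongr; omega))) c
    refine ⟨Function.update w k x, fun i hi => ?_⟩
    have hU : ⋃ j ∈ Finset.range i, G (Function.update w k x j) = ⋃ j ∈ Finset.range i, G (w j) := by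
      refine Set.iUnion₂_congr fun j hj => ?_
      rw [Function.update_of_ne (by have := Finset.mem_range.mp hj; omega)]
    rw [hU]
    rcases Nat.lt_succ_iff_lt_or_eq.mp hi with h | rfl
    · rw [Function.update_of_ne h.ne]
      exact hw i h
    · rw [Function.update_self]
      exact ⟨hxF, hx⟩

/-- A sequence of independent pairs with independent components is a pair of independent
sequences. -/
theorem map_zip_prod_iidLaw (P ν : Measure ℝ) [IsProbabilityMeasure P] [IsProbabilityMeasure ν] :
    ((iidLaw P).prod (iidLaw ν)).map (fun z i => (z.1 i, z.2 i))
      = Measure.infinitePi (fun _ : ℕ => P.prod ν) := by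
  refine Measure.eq_infinitePi _ fun I t ht => ?_
  have hm : Measurable fun (z : (ℕ → ℝ) × (ℕ → ℝ)) (i : ℕ) => (z.1 i, z.2 i) := by fun_prop
  have hbox : MeasurableSet ((Set.univ : Set I).pi fun i : I => t i) :=
    MeasurableSet.univ_pi fun i => ht i
  have h1 := (measurePreserving_arrowProdEquivProdArrow ℝ ℝ I (fun _ => P) (fun _ => ν)).symm
  have h2 : ((iidLaw P).prod (iidLaw ν)).map (Prod.map I.restrict I.restrict)
      = (Measure.pi fun _ : I => P).prod (Measure.pi fun _ : I => ν) := by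
    rw [← Measure.map_prod_map _ _ (by fun_prop) (by fun_prop), Measure.infinitePi_map_restrict,
      Measure.infinitePi_map_restrict]
  rw [Measure.map_apply hm (MeasurableSet.pi I.countable_toSet fun i _ => ht i)]
  have h3 : (fun (z : (ℕ → ℝ) × (ℕ → ℝ)) (i : ℕ) => (z.1 i, z.2 i)) ⁻¹' (I : Set ℕ).pi t
      = Prod.map I.restrict I.restrict ⁻¹' ((MeasurableEquiv.arrowProdEquivProdArrow ℝ ℝ I).symm ⁻¹'
        ((Set.univ : Set I).pi fun i : I => t i)) := by
    ext z
    simp only [Set.mem_preimage, Set.mem_pi, Set.mem_univ, true_imp_iff, Subtype.forall]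
    rfl
  rw [h3, ← Measure.map_apply (by fun_prop) (h1.measurable hbox), h2,
    ← Measure.map_apply h1.measurable hbox, h1.map_eq, Measure.pi_pi]
  exact Finset.prod_coe_sort I fun i => (P.prod ν) (t i)

theorem map_add_prod_iidLaw (P ν : Measure ℝ) [IsProbabilityMeasure P] [IsProbabilityMeasure ν] :
    ((iidLaw P).prod (iidLaw ν)).map (fun z => z.1 + z.2) = iidLaw (TimeModel.addLaw P ν) := by
  have h := Measure.infinitePi_map_pi (fun _ : ℕ => P.prod ν)
    (f := fun _ z => z.1 + z.2) (fun _ => by fun_prop)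
  rw [← map_zip_prod_iidLaw, Measure.map_map (by fun_prop) (by fun_prop)] at h
  exact h

theorem ae_tendsto_average {E : Type*} [MeasurableSpace E] (π : Measure E) [IsProbabilityMeasure π]
    {g : E → ℝ} (hg : Measurable g) (hint : Integrable g π) :
    ∀ᵐ ω ∂Measure.infinitePi (fun _ : ℕ => π),
      Tendsto (fun n : ℕ => (∑ i ∈ Finset.range n, g (ω i)) / n) atTop (𝓝 (∫ x, g x ∂π)) := by
  have hmp := fun i : ℕ => measurePreserving_eval_infinitePi (fun _ : ℕ => π) i
  have h := ProbabilityTheory.strong_law_ae_real (μ := Measure.infinitePi (fun _ : ℕ => π))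
    (fun i ω => g (ω i)) ((hmp 0).integrable_comp_of_integrable hint)
    (fun i j hij => (ProbabilityTheory.iIndepFun_infinitePi (P := fun _ : ℕ => π)
      (X := fun _ => g) fun _ => hg).indepFun hij) (fun i => ?_)
  · have h1 : ∫ ω : ℕ → E, g (ω 0) ∂Measure.infinitePi (fun _ : ℕ => π) = ∫ x, g x ∂π := by
      conv_rhs => rw [← (hmp 0).map_eq]
      rw [integral_map (hmp 0).measurable.aemeasurable hg.aestronglyMeasurable]
    rwa [h1] at h
  · refine ⟨(hg.comp (measurable_pi_apply i)).aemeasurable,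
      (hg.comp (measurable_pi_apply 0)).aemeasurable, ?_⟩
    have h2 : ∀ j, (Measure.infinitePi (fun _ : ℕ => π)).map (fun ω => g (ω j)) = π.map g := by
      intro j
      conv_rhs => rw [← (hmp j).map_eq, Measure.map_map hg (hmp j).measurable]
      rfl
    rw [h2, h2]

namespace TimeModel

variable {m : TimeModel} {ν P τ : Measure ℝ} [IsProbabilityMeasure ν] [IsProbabilityMeasure P]
  [IsProbabilityMeasure τ]

/-- The outputs for which, given `n` inputs `w`, the likelihood exceeds `γ` times the likelihood
for the output law `τ`. -/
def typicalOutputs (m : TimeModel) (ν τ : Measure ℝ) (γ : ℝ) (n : ℕ) (w : ℕ → ℝ) :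
    Set (ℕ → ℝ) :=
  {y | 0 < ∏ i ∈ Finset.range n, m.density τ (y i) ∧
    γ * ∏ i ∈ Finset.range n, m.density τ (y i) ≤ ∏ i ∈ Finset.range n, m.density ν (y i - w i)}

theorem measurableSet_typicalOutputs (m : TimeModel) (ν τ : Measure ℝ) (γ : ℝ) (n : ℕ) :
    MeasurableSet {z : (ℕ → ℝ) × (ℕ → ℝ) | z.2 ∈ typicalOutputs m ν τ γ n z.1} := by
  have h1 : Measurable fun z : (ℕ → ℝ) × (ℕ → ℝ) => ∏ i ∈ Finset.range n, m.density τ (z.2 i) :=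
    Finset.measurable_prod _ fun i _ => by fun_prop
  have h2 : Measurable fun z : (ℕ → ℝ) × (ℕ → ℝ) =>
      ∏ i ∈ Finset.range n, m.density ν (z.2 i - z.1 i) :=
    Finset.measurable_prod _ fun i _ => by fun_prop
  exact (measurableSet_lt measurable_const h1).inter (measurableSet_le (h1.const_mul γ) h2)

theorem typicalOutputs_congr {ν τ : Measure ℝ} {γ : ℝ} {n : ℕ} {w y y' : ℕ → ℝ} (h : ∀ i < n, y i = y' i) :
    y ∈ typicalOutputs m ν τ γ n w ↔ y' ∈ typicalOutputs m ν τ γ n w := by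
  have h1 : ∏ i ∈ Finset.range n, m.density τ (y i) = ∏ i ∈ Finset.range n, m.density τ (y' i) :=
    Finset.prod_congr rfl fun i hi => by rw [h i (Finset.mem_range.mp hi)]
  have h2 : ∏ i ∈ Finset.range n, m.density ν (y i - w i)
      = ∏ i ∈ Finset.range n, m.density ν (y' i - w i) :=
    Finset.prod_congr rfl fun i hi => by rw [h i (Finset.mem_range.mp hi)]
  simp only [typicalOutputs, Set.mem_ofPred_eq, h1, h2]

/-- An output that is independent of the input is typical with probability at most `γ⁻¹`, by
Markov's inequality for the likelihood ratio. -/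
theorem iidLaw_typicalOutputs_le (hν : ν ≪ m.refMeasure) (hτ : τ ≪ m.refMeasure) {γ : ℝ}
    (hγ : 0 < γ) (n : ℕ) {w : ℕ → ℝ} (hw : ∀ i, w i ∈ m.grid) :
    iidLaw τ (typicalOutputs m ν τ γ n w) ≤ ENNReal.ofReal γ⁻¹ := by
  let X : ℕ → (ℕ → ℝ) → ENNReal := fun i y =>
    ENNReal.ofReal (m.density ν (y i - w i) / m.density τ (y i))
  have hX1 : ∀ i, ∫⁻ y, X i y ∂iidLaw τ ≤ 1 := by
    intro i
    have h1 : ∫⁻ y, X i y ∂iidLaw τ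
        = ∫⁻ y, ENNReal.ofReal (m.density ν (y - w i) / m.density τ y) ∂τ :=
      (measurePreserving_eval_infinitePi (fun _ : ℕ => τ) i).lintegral_comp
        (f := fun y => ENNReal.ofReal (m.density ν (y - w i) / m.density τ y)) (by fun_prop)
    have h2 := lintegral_mul_div_density_le hτ (g := fun _ => 1) measurable_const
      (h := fun y => m.density ν (y - w i)) (by fun_prop)
    simp only [one_mul] at h2
    have h3 := m.lintegral_add_refMeasure (m.sub_mem_grid m.zero_mem_grid (hw i))
      (g := fun y => ENNReal.ofReal (m.density ν y)) (by fun_prop)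
    have h4 := lintegral_density_mul hν (g := fun _ => 1) measurable_const
    simp only [mul_one, lintegral_const, measure_univ] at h4
    rw [h1]
    refine h2.trans (le_of_eq ?_)
    rw [← h4, ← h3]
    refine lintegral_congr fun y => ?_
    congr 2
    ring
  have hXm : ∀ i, Measurable (X i) := fun i => by fun_prop
  have hprod : ∫⁻ y, ∏ i ∈ Finset.range n, X i y ∂iidLaw τ ≤ 1 := by
    rw [ProbabilityTheory.lintegral_prod_eq_prod_lintegral_of_indepFun _ X
      (ProbabilityTheory.iIndepFun_infinitePi (P := fun _ : ℕ => τ)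
        (X := fun i y => ENNReal.ofReal (m.density ν (y - w i) / m.density τ y))
        fun i => by fun_prop) hXm]
    exact Finset.prod_le_one' fun i _ => hX1 i
  have hsub : typicalOutputs m ν τ γ n w
      ⊆ {y | ENNReal.ofReal γ ≤ ∏ i ∈ Finset.range n, X i y} := by
    rintro y ⟨h1, h2⟩
    change ENNReal.ofReal γ ≤ ∏ i ∈ Finset.range n, X i y
    rw [← ENNReal.ofReal_prod_of_nonneg fun i _ => div_nonneg (density_nonneg _ _ _)
      (density_nonneg _ _ _), Finset.prod_div_distrib]
    exact ENNReal.ofReal_le_ofReal ((le_div_iff₀ h1).mpr h2)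
  refine (measure_mono hsub).trans ((meas_ge_le_lintegral_div
    (Finset.measurable_prod _ fun i _ => hXm i).aemeasurable
    (ENNReal.ofReal_pos.mpr hγ).ne' ENNReal.ofReal_ne_top).trans ?_)
  rw [ENNReal.ofReal_inv_of_pos hγ, ← one_div]
  gcongr

/-- The inputs in the set of times of the model whose first `n` letters have average at most `b`. -/
def cheapInputs (m : TimeModel) (b : ℝ) (n : ℕ) : Set (ℕ → ℝ) :=
  {w | (∀ i, w i ∈ m.times) ∧ ∑ i ∈ Finset.range n, w i ≤ n * b}

theorem measurableSet_cheapInputs (m : TimeModel) (b : ℝ) (n : ℕ) :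
    MeasurableSet (cheapInputs m b n) := by
  have h1 : MeasurableSet {w : ℕ → ℝ | ∀ i, w i ∈ m.times} := by
    have : {w : ℕ → ℝ | ∀ i, w i ∈ m.times} = ⋂ i, (fun w => w i) ⁻¹' m.times := by
      ext w
      simp
    rw [this]
    exact MeasurableSet.iInter fun i => measurable_pi_apply i m.measurableSet_times
  exact h1.inter (measurableSet_le (Finset.measurable_sum _ fun i _ => measurable_pi_apply i)
    measurable_const)

/-- The law of large numbers, for the likelihood ratio and for the cost of the input. -/
theorem tendsto_lintegral_typicalOutputs (hν : IsService m ν) (hP : ∀ᵐ w ∂P, w ∈ m.times)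
    (hint : Integrable (fun w : ℝ => w) P) {δ I b : ℝ} (hδ : 0 < δ)
    (hI : I = ∫ x, Real.log (m.density ν x) ∂ν
      - ∫ x, Real.log (m.density (addLaw P ν) x) ∂addLaw P ν)
    (hb : ∫ w, w ∂P < b) :
    Tendsto (fun n : ℕ => ∫⁻ w in cheapInputs m b n, (iidLaw ν).map (fun s => w + s)
      (typicalOutputs m ν (addLaw P ν) (Real.exp (n * (I - δ))) n w) ∂iidLaw P)
      atTop (𝓝 1) := by
  have hout := hν.addLaw hP hint
  let A : ℕ → Set ((ℕ → ℝ) × (ℕ → ℝ)) := fun n => {z | z.1 ∈ cheapInputs m b n ∧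
    z.1 + z.2 ∈ typicalOutputs m ν (addLaw P ν) (Real.exp (n * (I - δ))) n z.1}
  have hA1 : ∀ n : ℕ, MeasurableSet {z : (ℕ → ℝ) × (ℕ → ℝ) | z.1 + z.2 ∈
      typicalOutputs m ν (addLaw P ν) (Real.exp (n * (I - δ))) n z.1} := fun n =>
    (by fun_prop : Measurable fun z : (ℕ → ℝ) × (ℕ → ℝ) => (z.1, z.1 + z.2))
      (measurableSet_typicalOutputs m ν (addLaw P ν) (Real.exp (n * (I - δ))) n)
  have hA : ∀ n, MeasurableSet (A n) := fun n =>
    (measurable_fst (measurableSet_cheapInputs m b n)).inter (hA1 n)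
  have heq : ∀ n : ℕ, ∫⁻ w in cheapInputs m b n, (iidLaw ν).map (fun s => w + s)
      (typicalOutputs m ν (addLaw P ν) (Real.exp (n * (I - δ))) n w) ∂iidLaw P
      = ((iidLaw P).prod (iidLaw ν)) (A n) := by
    intro n
    rw [Measure.prod_apply (hA n), ← lintegral_indicator (measurableSet_cheapInputs m b n)]
    refine lintegral_congr fun w => ?_
    have hG : MeasurableSet (typicalOutputs m ν (addLaw P ν) (Real.exp (n * (I - δ))) n w) :=
      (measurable_prodMk_left : Measurable (Prod.mk w))
        (measurableSet_typicalOutputs m ν (addLaw P ν) (Real.exp (n * (I - δ))) n)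
    by_cases hw : w ∈ cheapInputs m b n
    · rw [Set.indicator_of_mem hw, Measure.map_apply (by fun_prop) hG]
      congr 1
      ext s
      simp [A, hw]
    · rw [Set.indicator_of_notMem hw]
      simp [A, hw]
  simp only [heq]
  have hmeas : Measurable fun z : ℝ × ℝ => Real.log (m.density ν z.2)
      - Real.log (m.density (addLaw P ν) (z.1 + z.2)) := by fun_prop
  have hi2 : Integrable (fun z : ℝ × ℝ => Real.log (m.density (addLaw P ν) (z.1 + z.2)))
      (P.prod ν) := hout.integrable_log.comp_measurable (f := fun z : ℝ × ℝ => z.1 + z.2)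
        (by fun_prop)
  have hi1 : Integrable (fun z : ℝ × ℝ => Real.log (m.density ν z.2)) (P.prod ν) :=
    hν.integrable_log.comp_snd P
  have hmean : ∫ z : ℝ × ℝ, (Real.log (m.density ν z.2)
      - Real.log (m.density (addLaw P ν) (z.1 + z.2))) ∂P.prod ν = I := by
    rw [integral_sub hi1 hi2, hI]
    congr 1
    · have h := integral_fun_snd (μ := P) (ν := ν) fun x => Real.log (m.density ν x)
      simpa using h
    · exact (integral_map (φ := fun z : ℝ × ℝ => z.1 + z.2) (by fun_prop)
        hout.integrable_log.1).symm
  have hcost : ∫ z : ℝ × ℝ, z.1 ∂P.prod ν = ∫ w, w ∂P := by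
    have h := integral_fun_fst (μ := P) (ν := ν) fun x => x
    simpa using h
  have hLLN1 := ae_tendsto_average (P.prod ν) hmeas (hi1.sub hi2)
  have hLLN2 := ae_tendsto_average (P.prod ν) measurable_fst (hint.comp_fst ν)
  rw [hmean] at hLLN1
  rw [hcost] at hLLN2
  have hpair : ∀ᵐ z : ℝ × ℝ ∂P.prod ν, z.1 ∈ m.times ∧ 0 < m.density ν z.2 ∧
      0 < m.density (addLaw P ν) (z.1 + z.2) := by
    have h1 := density_pos hout.absolutelyContinuous
    filter_upwards [Measure.quasiMeasurePreserving_fst.ae hP,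
      Measure.quasiMeasurePreserving_snd.ae (density_pos hν.absolutelyContinuous),
      ae_of_ae_map (f := fun z : ℝ × ℝ => z.1 + z.2) (by fun_prop) h1] with z h2 h3 h4
    exact ⟨h2, h3, h4⟩
  have hall : ∀ᵐ ω ∂Measure.infinitePi (fun _ : ℕ => P.prod ν), ∀ i : ℕ, (ω i).1 ∈ m.times ∧
      0 < m.density ν (ω i).2 ∧ 0 < m.density (addLaw P ν) ((ω i).1 + (ω i).2) :=
    ae_all_iff.mpr fun i => (measurePreserving_eval_infinitePi
      (fun _ : ℕ => P.prod ν) i).quasiMeasurePreserving.ae hpair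
  have hzip : Measurable fun (z : (ℕ → ℝ) × (ℕ → ℝ)) (i : ℕ) => (z.1 i, z.2 i) := by fun_prop
  rw [← map_zip_prod_iidLaw] at hLLN1 hLLN2 hall
  have hlim : ∀ᵐ z ∂(iidLaw P).prod (iidLaw ν), ∀ᶠ n in atTop, z ∈ A n ↔ z ∈ Set.univ := by
    filter_upwards [ae_of_ae_map hzip.aemeasurable hLLN1, ae_of_ae_map hzip.aemeasurable hLLN2,
      ae_of_ae_map hzip.aemeasurable hall] with z h1 h2 h3
    filter_upwards [h1.eventually (lt_mem_nhds (by linarith : I - δ < I)),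
      h2.eventually (gt_mem_nhds hb), eventually_gt_atTop 0] with n h4 h5 hn
    have hn' : (0 : ℝ) < n := by exact_mod_cast hn
    simp only [Set.mem_univ, iff_true]
    rw [div_lt_iff₀ hn'] at h5
    rw [lt_div_iff₀ hn'] at h4
    refine ⟨⟨fun i => (h3 i).1, by linarith⟩, ?_, ?_⟩
    · exact Finset.prod_pos fun i _ => (h3 i).2.2
    · have h6 : ∏ i ∈ Finset.range n, m.density ν ((z.1 + z.2) i - z.1 i)
          = Real.exp (∑ i ∈ Finset.range n, Real.log (m.density ν (z.2 i))) := by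
        rw [Real.exp_sum]
        refine Finset.prod_congr rfl fun i _ => ?_
        rw [Real.exp_log (h3 i).2.1, Pi.add_apply, add_sub_cancel_left]
      have h7 : ∏ i ∈ Finset.range n, m.density (addLaw P ν) ((z.1 + z.2) i)
          = Real.exp (∑ i ∈ Finset.range n, Real.log (m.density (addLaw P ν) (z.1 i + z.2 i))) := by
        rw [Real.exp_sum]
        exact Finset.prod_congr rfl fun i _ => (Real.exp_log (h3 i).2.2).symm
      rw [h6, h7, ← Real.exp_add]
      refine Real.exp_le_exp.mpr ?_
      rw [Finset.sum_sub_distrib] at h4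
      linarith
  have h := tendsto_measure_of_ae_tendsto_indicator_of_isFiniteMeasure atTop
    MeasurableSet.univ hA hlim
  simpa using h

end TimeModel

namespace TimeModel

variable {m : TimeModel} {ν P : Measure ℝ} [IsProbabilityMeasure ν] [IsProbabilityMeasure P]

/-- The coding theorem for the memoryless channel `w ↦ w + S`: at any rate below
`I = H(W + S) - H(S)` (in nats) there are codebooks with vanishing error probability whose codewords
have mean at most `b`, if `b` exceeds the mean of `W`. -/
theorem exists_codebook (hν : IsService m ν) (hP : ∀ᵐ w ∂P, w ∈ m.times)
    (hint : Integrable (fun w : ℝ => w) P) {δ I b : ℝ} (hδ : 0 < δ) (hδI : δ < I)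
    (hI : I = ∫ x, Real.log (m.density ν x) ∂ν
      - ∫ x, Real.log (m.density (addLaw P ν) x) ∂addLaw P ν)
    (hb : ∫ w, w ∂P < b) :
    ∃ ε : ℕ → ℝ, Tendsto ε atTop (𝓝 0) ∧ ∀ᶠ n : ℕ in atTop,
      ∃ (M : ℕ) (w : Fin M → ℕ → ℝ) (D : Fin M → Set (ℕ → ℝ)),
        Real.exp (n * (I - 2 * δ)) ≤ M ∧ (∀ u i, w u i ∈ m.times) ∧
        (∀ u, ∑ i ∈ Finset.range n, w u i ≤ n * b) ∧ (∀ u, MeasurableSet (D u)) ∧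
        (∀ u v, u ≠ v → Disjoint (D u) (D v)) ∧
        (∀ u y y', (∀ i < n, y i = y' i) → (y ∈ D u ↔ y' ∈ D u)) ∧
        ∀ u, 1 - ε n ≤ (iidLaw ν).real {s | w u + s ∈ D u} := by
  have hout := hν.addLaw hP hint
  let γ : ℕ → ℝ := fun n => Real.exp (n * (I - δ))
  let G : ℕ → (ℕ → ℝ) → Set (ℕ → ℝ) := fun n => typicalOutputs m ν (addLaw P ν) (γ n) n
  let S : ℕ → ENNReal := fun n => ∫⁻ w in cheapInputs m b n,
    (iidLaw ν).map (fun s => w + s) (G n w) ∂iidLaw P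
  have hS : Tendsto S atTop (𝓝 1) := tendsto_lintegral_typicalOutputs hν hP hint hδ hI hb
  let M : ℕ → ℕ := fun n => ⌈Real.exp (n * (I - 2 * δ))⌉₊
  have hp : Tendsto (fun n => (S n).toReal) atTop (𝓝 1) := by
    exact (ENNReal.tendsto_toReal ENNReal.one_ne_top).comp hS
  have hexp : ∀ c : ℝ, 0 < c → Tendsto (fun n : ℕ => Real.exp (-(n * c))) atTop (𝓝 0) := by
    intro c hc
    refine Real.tendsto_exp_atBot.comp (tendsto_neg_atTop_atBot.comp ?_)
    exact tendsto_natCast_atTop_atTop.atTop_mul_const hc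
  have hMγ : Tendsto (fun n => M n * (γ n)⁻¹) atTop (𝓝 0) := by
    have h1 : Tendsto (fun n : ℕ => Real.exp (-(n * δ)) + Real.exp (-(n * (I - δ)))) atTop
        (𝓝 0) := by
      simpa using (hexp δ hδ).add (hexp (I - δ) (by linarith))
    refine squeeze_zero (fun n => by positivity) (fun n => ?_) h1
    have h2 : (M n : ℝ) ≤ Real.exp (n * (I - 2 * δ)) + 1 :=
      (Nat.ceil_lt_add_one (Real.exp_nonneg _)).le
    calc (M n : ℝ) * (γ n)⁻¹ ≤ (Real.exp (n * (I - 2 * δ)) + 1) * (γ n)⁻¹ := by gcongr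
      _ = Real.exp (-(n * δ)) + Real.exp (-(n * (I - δ))) := by
        rw [add_mul, one_mul, ← Real.exp_neg, ← Real.exp_add]
        congr 2
        ring
  refine ⟨fun n => 1 - (S n).toReal + M n * (γ n)⁻¹ + 1 / ((n : ℝ) + 1), ?_, ?_⟩
  · simpa using ((tendsto_const_nhds (x := (1 : ℝ))).sub hp).add hMγ |>.add
      tendsto_one_div_add_atTop_nhds_zero_nat
  have hε : Tendsto (fun n => (S n).toReal - M n * (γ n)⁻¹ - 1 / ((n : ℝ) + 1)) atTop (𝓝 1) := by
    simpa using (hp.sub hMγ).sub tendsto_one_div_add_atTop_nhds_zero_nat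
  filter_upwards [hε.eventually (lt_mem_nhds zero_lt_one), hS.eventually
    (gt_mem_nhds ENNReal.one_lt_top)] with n hn hn2
  have hγ : 0 < γ n := Real.exp_pos _
  have hn1 : (0 : ℝ) < 1 / ((n : ℝ) + 1) := by positivity
  have hMn : 0 ≤ M n * (γ n)⁻¹ := by positivity
  have hGm : ∀ w, MeasurableSet (G n w) := fun w =>
    (measurable_prodMk_left : Measurable (Prod.mk w))
      (measurableSet_typicalOutputs m ν (addLaw P ν) (γ n) n)
  obtain ⟨w, hw⟩ := exists_codewords (iidLaw P) (fun w => (iidLaw ν).map (fun s => w + s))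
    (iidLaw (addLaw P ν)) (G n) (cheapInputs m b n) (β := ENNReal.ofReal (γ n)⁻¹)
    (c := ENNReal.ofReal ((S n).toReal - M n * (γ n)⁻¹ - 1 / ((n : ℝ) + 1))) (k := M n)
    (measurableSet_cheapInputs m b n) hGm
    (fun B hB => by
      rw [← map_add_prod_iidLaw, Measure.map_apply (by fun_prop) hB,
        Measure.prod_apply (measurableSet_preimage (by fun_prop) hB)]
      refine lintegral_mono fun w => ?_
      rw [Measure.map_apply (by fun_prop) hB]
      rfl)
    (fun w hw => iidLaw_typicalOutputs_le hν.absolutelyContinuous hout.absolutelyContinuous hγ n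
      fun i => (hw.1 i).1)
    (by
      change _ < S n
      rw [← ENNReal.ofReal_natCast, ← ENNReal.ofReal_mul (by positivity),
        ← ENNReal.ofReal_add hn.le hMn]
      conv_rhs => rw [← ENNReal.ofReal_toReal hn2.ne]
      rw [ENNReal.ofReal_lt_ofReal_iff (by linarith)]
      linarith)
  let D : Fin (M n) → Set (ℕ → ℝ) := fun u => G n (w u) \ ⋃ j ∈ Finset.range u, G n (w j)
  have hD : ∀ u, MeasurableSet (D u) := fun u =>
    (hGm _).diff (Finset.measurableSet_biUnion _ fun j _ => hGm _)
  have hdis : ∀ u v : Fin (M n), u < v → Disjoint (D u) (D v) := by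
    intro u v huv
    refine Set.disjoint_left.mpr fun y hu hv => hv.2 ?_
    exact Set.mem_biUnion (Finset.mem_range.mpr huv) hu.1
  refine ⟨M n, fun u => w u, D, Nat.le_ceil _, fun u i => (hw u u.2).1.1 i,
    fun u => (hw u u.2).1.2, hD, fun u v huv => ?_, fun u y y' h => ?_, fun u => ?_⟩
  · rcases lt_or_gt_of_ne huv with h | h
    · exact hdis u v h
    · exact (hdis v u h).symm
  · simp only [D, Set.mem_sdiff, Set.mem_iUnion, G,
      typicalOutputs_congr (m := m) (ν := ν) (τ := addLaw P ν) h]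
  · have h1 := (hw u u.2).2
    rw [Measure.map_apply (by fun_prop) (hD u)] at h1
    refine le_trans (le_of_eq (by ring)) ((ENNReal.ofReal_le_iff_le_toReal ?_).mp h1)
    exact measure_ne_top _ _

end TimeModel

namespace Queue

/-! ### Idle times as the input of a memoryless channel -/

/-- The encoder that makes `w i` the idle time before packet `i`: the packet is sent
`w i` after the previous departure. If `w i = 0`, it is already sent together with the previous
packet and waits in the queue, since that departure is not known at the time at which it occurs. -/
def sendAfter (w : ℕ → ℝ) : ℕ → (ℕ → ℝ) → ℝ
  | 0 => fun _ => w 0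
  | i + 1 => fun d => if 0 < w (i + 1) then d i + w (i + 1) else sendAfter w i d

section SendAfter

variable {w s : ℕ → ℝ} {i : ℕ}

theorem measurable_sendAfter (w : ℕ → ℝ) (i : ℕ) : Measurable (sendAfter w i) := by
  induction i with
  | zero => exact measurable_const
  | succ i ih =>
    by_cases h : 0 < w (i + 1)
    · simp only [sendAfter, h, if_true]
      fun_prop
    · simpa only [sendAfter, h, if_false] using ih

theorem sendAfter_congr {d d' : ℕ → ℝ} (h : ∀ k < i, d k = d' k) :
    sendAfter w i d = sendAfter w i d' := by
  induction i with
  | zero => rfl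
  | succ i ih =>
    simp only [sendAfter, h i (Nat.lt_succ_self i), ih fun k hk => h k (by omega)]

theorem sendAfter_causal {d d' : ℕ → ℝ}
    (h : ∀ k < i, min (d k) (sendAfter w i d) = min (d' k) (sendAfter w i d)) :
    sendAfter w i d' = sendAfter w i d := by
  induction i with
  | zero => rfl
  | succ i ih =>
    by_cases hw : 0 < w (i + 1)
    · simp only [sendAfter, hw, if_true] at h ⊢
      have h1 := h i (Nat.lt_succ_self i)
      rw [min_eq_left (by linarith)] at h1
      rcases min_choice (d' i) (d i + w (i + 1)) with h2 | h2
      · rw [h1, h2]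
      · linarith
    · simp only [sendAfter, hw, if_false] at h ⊢
      exact ih fun k hk => h k (by omega)

theorem arrival_sendAfter_succ : arrival (sendAfter w) s (i + 1)
    = if 0 < w (i + 1) then departure (sendAfter w) s i + w (i + 1)
      else arrival (sendAfter w) s i := by
  by_cases h : 0 < w (i + 1)
  · simp only [arrival, sendAfter, h, if_true]
    rfl
  · simp only [arrival, sendAfter, h, if_false]
    refine sendAfter_congr fun k hk => ?_
    rw [history_apply _ _ hk, history_apply _ _ (by omega)]

theorem arrival_le_departure (f : ℕ → (ℕ → ℝ) → ℝ) (hs : ∀ k, 0 ≤ s k) :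
    arrival f s i ≤ departure f s i := by
  rw [departure_eq]
  have := hs i
  linarith [le_max_left (arrival f s i) (previous (departure f s) i)]

theorem idle_sendAfter (hw : ∀ k, 0 ≤ w k) (hs : ∀ k, 0 ≤ s k) : idle (sendAfter w) s i = w i := by
  cases i with
  | zero =>
    change max (w 0) 0 - 0 = w 0
    rw [max_eq_left (hw 0), sub_zero]
  | succ i =>
    have h : previous (history (sendAfter w) s (i + 1)) (i + 1) = departure (sendAfter w) s i := rfl
    rw [idle, start, h, arrival_sendAfter_succ]
    split_ifs with h1
    · rw [max_eq_left (by linarith)]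
      ring
    · rw [max_eq_right (arrival_le_departure _ hs)]
      linarith [hw (i + 1)]

theorem arrival_sendAfter_mono (hs : ∀ k, 0 ≤ s k) : Monotone (arrival (sendAfter w) s) := by
  refine monotone_nat_of_le_succ fun i => ?_
  rw [arrival_sendAfter_succ]
  split_ifs with h
  · linarith [arrival_le_departure (i := i) (sendAfter w) hs]
  · exact le_rfl

theorem arrival_sendAfter_mem {m : TimeModel} (hw : ∀ k, w k ∈ m.times)
    (hs : ∀ k, s k ∈ m.times) : arrival (sendAfter w) s i ∈ m.times := by
  have h : arrival (sendAfter w) s i ∈ m.times ∧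
      previous (departure (sendAfter w) s) i ∈ m.times := by
    induction i with
    | zero => exact ⟨hw 0, m.zero_mem_times⟩
    | succ i ih =>
      have hd : departure (sendAfter w) s i ∈ m.times := by
        rw [← previous_departure_add, idle_sendAfter (fun k => (hw k).2) fun k => (hs k).2]
        exact m.add_mem_times ih.2 (m.add_mem_times (hw i) (hs i))
      refine ⟨?_, hd⟩
      rw [arrival_sendAfter_succ]
      split_ifs
      · exact m.add_mem_times hd (hw _)
      · exact ih.1
  exact h.1

end SendAfter

variable {m : TimeModel} {ν : Measure ℝ} [IsProbabilityMeasure ν]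

theorem exists_measurable_decoder {Y : Type*} [MeasurableSpace Y] {M : ℕ} (hM : 0 < M)
    (D : Fin M → Set Y) (hD : ∀ u, MeasurableSet (D u))
    (hdis : ∀ u v, u ≠ v → Disjoint (D u) (D v)) :
    ∃ g : Y → Fin M, Measurable g ∧ ∀ u, ∀ y ∈ D u, g y = u := by
  have : Nonempty (Fin M) := ⟨⟨0, hM⟩⟩
  obtain ⟨g, hg, h⟩ := exists_measurable_piecewise D hD (fun u _ => u)
    (fun u => measurable_const) (fun u v huv => by
      intro y hy
      exact absurd hy.2 (Set.disjoint_left.mp (hdis u v huv) hy.1))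
  exact ⟨g, hg, fun u y hy => h u hy⟩

/-- The gaps between the departures in a record of `N` departures, continued by zero. -/
def gaps {N : ℕ} (d : Fin N → ℝ) (i : ℕ) : ℝ :=
  if h : i < N then
    d ⟨i, h⟩ - previous (fun k => if hk : k < N then d ⟨k, hk⟩ else 0) i
  else 0

theorem measurable_gaps (N : ℕ) : Measurable (gaps : (Fin N → ℝ) → ℕ → ℝ) := by
  refine measurable_pi_lambda _ fun i => ?_
  have h1 : Measurable fun (d : Fin N → ℝ) (k : ℕ) => if hk : k < N then d ⟨k, hk⟩ else 0 := by
    refine measurable_pi_lambda _ fun k => ?_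
    by_cases hk : k < N
    · simp only [hk, dite_true]
      fun_prop
    · simp only [hk, dite_false]
      fun_prop
  by_cases h : i < N
  · simp only [gaps, h, dite_true]
    exact (measurable_pi_apply _).sub ((measurable_previous i).comp h1)
  · simp only [gaps, h, dite_false]
    fun_prop

theorem gaps_departure (f : ℕ → (ℕ → ℝ) → ℝ) (s : ℕ → ℝ) {N i : ℕ} (hi : i < N) :
    gaps (fun k : Fin N => departure f s k) i = idle f s i + s i := by
  have h : previous (fun k => if hk : k < N then departure f s k else 0) i
      = previous (departure f s) i := by
    cases i with
    | zero => rfl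
    | succ i =>
      have hi' : i < N := by omega
      simp [previous, hi']
  rw [gaps, dif_pos hi, h, ← previous_departure_add, add_sub_cancel_left]

/-- A codebook for the idle times of `n` packets makes a feedback code for `N ≥ n` packets: the
idle times of the other packets are zero. -/
theorem exists_feedbackCode (hν : TimeModel.IsService m ν) {n N M : ℕ} (hn : n ≤ N) (hM : 0 < M)
    {w : Fin M → ℕ → ℝ} {D : Fin M → Set (ℕ → ℝ)} {B ε : ℝ} (hw : ∀ u i, w u i ∈ m.times)
    (hB : ∀ u, ∑ i ∈ Finset.range n, w u i ≤ B) (hD : ∀ u, MeasurableSet (D u))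
    (hdis : ∀ u v, u ≠ v → Disjoint (D u) (D v))
    (hcongr : ∀ u (y y' : ℕ → ℝ), (∀ i < n, y i = y' i) → (y ∈ D u ↔ y' ∈ D u))
    (hε : ∀ u, 1 - ε ≤ (iidLaw ν).real {s | w u + s ∈ D u}) :
    ∃ c : FeedbackCode m N M, c.Meets ν (B + N * ∫ s, s ∂ν) ε := by
  obtain ⟨g, hg, hgD⟩ := exists_measurable_decoder hM D hD hdis
  let w' : Fin M → ℕ → ℝ := fun u i => if i < n then w u i else 0
  have hw' : ∀ u i, w' u i ∈ m.times := by
    intro u i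
    by_cases h : i < n
    · simpa only [w', h, if_true] using hw u i
    · simpa only [w', h, if_false] using m.zero_mem_times
  let c : FeedbackCode m N M :=
    { enc := fun u => sendAfter (w' u)
      dec := fun d => g (gaps d)
      measurable_enc := fun u i _ => measurable_sendAfter _ i
      measurable_dec := hg.comp (measurable_gaps N)
      causal := fun u i _ d d' h => sendAfter_causal h
      arrival_mem := fun u s hs i _ => arrival_sendAfter_mem (hw' u) hs
      arrival_mono := fun u s hs i j hij _ => arrival_sendAfter_mono (fun k => (hs k).2) hij }
  have hidle : ∀ u (s : ℕ → ℝ), (∀ k, s k ∈ m.times) → ∀ i, idle (c.enc u) s i = w' u i :=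
    fun u s hs i => idle_sendAfter (fun k => (hw' u k).2) fun k => (hs k).2
  have hM' : (0 : ℝ) < M := by exact_mod_cast hM
  have hM0 : (M : ENNReal) ≠ 0 := by exact_mod_cast hM.ne'
  refine ⟨c, ?_, ?_⟩
  · have hcost : ∀ u, ∫⁻ s, ENNReal.ofReal (previous (departure (c.enc u) s) N) ∂iidLaw ν
        ≤ ENNReal.ofReal (B + N * ∫ s, s ∂ν) := by
      intro u
      have hsum : ∑ i ∈ Finset.range N, w' u i ≤ B := by
        refine le_trans (le_of_eq ?_) (hB u)
        obtain ⟨k, rfl⟩ := Nat.exists_eq_add_of_le hn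
        rw [Finset.sum_range_add]
        have h1 : ∀ i ∈ Finset.range n, w' u i = w u i := fun i hi => by
          simp [w', Finset.mem_range.mp hi]
        rw [Finset.sum_congr rfl h1]
        simp [w']
      have hint1 : ∀ i ∈ Finset.range N, Integrable (fun s : ℕ → ℝ => w' u i + s i) (iidLaw ν) :=
        fun i _ => (integrable_const _).add (integrable_eval_iidLaw hν.integrable i)
      have hint : Integrable (fun s : ℕ → ℝ => ∑ i ∈ Finset.range N, (w' u i + s i))
          (iidLaw ν) := integrable_finsetSum _ hint1
      have h2 : ∀ᵐ s ∂iidLaw ν, ENNReal.ofReal (previous (departure (c.enc u) s) N)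
          = ENNReal.ofReal (∑ i ∈ Finset.range N, (w' u i + s i)) := by
        filter_upwards [iidLaw_ae hν.mem_times] with s hs
        rw [previous_departure_eq_sum]
        congr 1
        exact Finset.sum_congr rfl fun i _ => by rw [hidle u s hs]
      have h3 : ∀ᵐ s ∂iidLaw ν, 0 ≤ ∑ i ∈ Finset.range N, (w' u i + s i) := by
        filter_upwards [iidLaw_ae hν.mem_times] with s hs
        exact Finset.sum_nonneg fun i _ => add_nonneg (hw' u i).2 (hs i).2
      rw [lintegral_congr_ae h2, ← ofReal_integral_eq_lintegral_ofReal hint h3]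
      refine ENNReal.ofReal_le_ofReal ?_
      rw [integral_finsetSum _ hint1]
      have h4 : ∀ i ∈ Finset.range N, ∫ s : ℕ → ℝ, (w' u i + s i) ∂iidLaw ν
          = w' u i + ∫ s, s ∂ν := by
        intro i _
        rw [integral_add (integrable_const _) (integrable_eval_iidLaw hν.integrable i),
          integral_eval_iidLaw hν.integrable]
        simp
      rw [Finset.sum_congr rfl h4, Finset.sum_add_distrib]
      simpa using hsum
    rw [ENNReal.div_le_iff hM0 (by simp)]
    refine (Finset.sum_le_sum fun u _ => hcost u).trans ?_
    simp [mul_comm]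
  · have herr : ∀ u, (iidLaw ν).real
        {s | c.dec (fun i : Fin N => departure (c.enc u) s i) ≠ u} ≤ ε := by
      intro u
      have hmeas : MeasurableSet {s : ℕ → ℝ | w u + s ∈ D u} :=
        (by fun_prop : Measurable fun s : ℕ → ℝ => w u + s) (hD u)
      have h1 : (iidLaw ν).real {s : ℕ → ℝ | w u + s ∈ D u}ᶜ ≤ ε := by
        rw [probReal_compl_eq_one_sub hmeas]
        linarith [hε u]
      refine le_trans ?_ h1
      refine ENNReal.toReal_mono (measure_ne_top _ _) (measure_mono_ae ?_)
      filter_upwards [iidLaw_ae hν.mem_times] with s hs hne hmem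
      refine hne (hgD u _ ((hcongr u _ _ fun i hi => ?_).mpr hmem))
      rw [gaps_departure _ _ (hi.trans_le hn), hidle u s hs, Pi.add_apply]
      simp [w', hi]
    rw [div_le_iff₀ hM']
    refine (Finset.sum_le_sum fun u _ => herr u).trans ?_
    simp [mul_comm]

end Queue

namespace Queue

variable {m : TimeModel} {ν : Measure ℝ} [IsProbabilityMeasure ν]

/-! ### Bounds on the two capacities -/

theorem tendsto_log_add_two_div : Tendsto (fun n : ℕ => Real.log (n + 2) / ((n : ℝ) + 1)) atTop
    (𝓝 0) := by
  have h1 : Tendsto (fun n : ℕ => (n : ℝ) + 2) atTop atTop :=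
    tendsto_atTop_add_const_right _ _ tendsto_natCast_atTop_atTop
  have h2 := (Real.isLittleO_log_id_atTop.tendsto_div_nhds_zero).comp h1
  have h3 := h2.mul ((tendsto_const_nhds (x := (1 : ℝ))).add
    (tendsto_one_div_add_atTop_nhds_zero_nat (𝕜 := ℝ)))
  rw [zero_mul] at h3
  refine h3.congr fun n => ?_
  have h4 : (n : ℝ) + 1 ≠ 0 := by positivity
  have h5 : (n : ℝ) + 2 ≠ 0 := by positivity
  simp only [Function.comp, id]
  field_simp
  ring

theorem capacity_le (hν : TimeModel.IsService m ν) {lam mu J : ℝ} (hlam : 0 < lam)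
    (hlt : lam < mu) (hmean : ∫ s, s ∂ν = 1 / mu)
    (hJ : m.maxEntropyDelayed ν (1 / lam - 1 / mu) ≤ (J : EReal)) :
    capacity m ν lam
      ≤ ((lam * (J + (∫ x, Real.log (m.density ν x) ∂ν) / Real.log 2) : ℝ) : EReal) := by
  have hlog : 0 < Real.log 2 := Real.log_pos (by norm_num)
  set r := ∫ x, Real.log (m.density ν x) ∂ν with hr
  have hK : ∀ (P : Measure ℝ) [IsProbabilityMeasure P], (∀ᵐ x ∂P, x ∈ m.grid) →
      ∫⁻ w, ENNReal.ofReal w ∂TimeModel.idleLaw P ν ≤ ENNReal.ofReal (1 / lam - 1 / mu) →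
      -∫ x, Real.log (m.density (TimeModel.addLaw (TimeModel.idleLaw P ν) ν) x)
        ∂TimeModel.addLaw (TimeModel.idleLaw P ν) ν ≤ J * Real.log 2 := by
    intro P _ hP hcost
    have h1 := (TimeModel.entropy_le_maxEntropyDelayed hP hcost).trans hJ
    have h2 := TimeModel.idleLaw_mem_times hP hν.mem_times
    rw [(hν.addLaw h2 (TimeModel.integrable_of_lintegral_ofReal_le h2 hcost)).entropy,
      EReal.coe_le_coe_iff, div_le_iff₀ hlog] at h1
    exact h1
  refine iSup₂_le fun R hR => EReal.coe_le_coe_iff.mpr (le_of_forall_pos_le_add fun γ hγ => ?_)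
  obtain ⟨ε, hε, hev⟩ := hR γ hγ
  rw [← sub_le_iff_le_add]
  set C : ℝ := Real.log m.heavyMass + 2 * (1 / lam + 1) + Real.log 2 + r with hC
  have hε' : Tendsto (fun n => ε (n + 1)) atTop (𝓝 0) := hε.comp (tendsto_add_atTop_nat 1)
  have hlim : Tendsto (fun n : ℕ => lam / Real.log 2 * ((J * Real.log 2 + r
      + (2 * (Real.log (n + 2) / ((n : ℝ) + 1)) + C * (1 / ((n : ℝ) + 1)))) / (1 - ε (n + 1))))
      atTop (𝓝 (lam / Real.log 2 * ((J * Real.log 2 + r + (2 * 0 + C * 0)) / (1 - 0)))) := by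
    refine Tendsto.const_mul _ (Tendsto.div (tendsto_const_nhds.add
      ((tendsto_log_add_two_div.const_mul 2).add
        (tendsto_one_div_add_atTop_nhds_zero_nat.const_mul C))) (tendsto_const_nhds.sub hε')
      (by norm_num))
  have heq : lam / Real.log 2 * ((J * Real.log 2 + r + (2 * 0 + C * 0)) / (1 - 0))
      = lam * (J + r / Real.log 2) := by
    field_simp
    ring
  rw [heq] at hlim
  refine ge_of_tendsto hlim ?_
  filter_upwards [(tendsto_add_atTop_nat 1).eventually hev,
    hε'.eventually (gt_mem_nhds zero_lt_one)] with n hn hn1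
  obtain ⟨M, c, hno, hc, hrate⟩ := hn
  have h1 := hno.log_card_le hν hlam hlt hmean hK hc
  have hn0 : (0 : ℝ) < n + 1 := by positivity
  have h2 : Real.log M ≤ ((n + 1) * (J * Real.log 2 + r) + 2 * Real.log (n + 2) + C)
      / (1 - ε (n + 1)) := by
    rw [le_div_iff₀ (by linarith)]
    linarith
  refine hrate.le.trans ?_
  rw [Real.logb]
  push_cast
  calc lam * (Real.log M / Real.log 2 / ((n : ℝ) + 1))
      ≤ lam * (((n + 1) * (J * Real.log 2 + r) + 2 * Real.log (n + 2) + C)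
        / (1 - ε (n + 1)) / Real.log 2 / ((n : ℝ) + 1)) := by gcongr
    _ = _ := by
      have h3 : 1 - ε (n + 1) ≠ 0 := by linarith
      field_simp
      ring

/-- Any law `P` of the idle times within the mean constraint gives an achievable rate. The
excess `δ` over the mean which the codewords need is
paid for by sending information with a fraction `a / (a + δ)` of the packets only. -/
theorem achievableWithFeedback (hν : TimeModel.IsService m ν) {lam mu I : ℝ} (hlam : 0 < lam)
    (hlt : lam < mu) (hmean : ∫ s, s ∂ν = 1 / mu) {P : Measure ℝ} [IsProbabilityMeasure P]
    (hP : ∀ᵐ w ∂P, w ∈ m.times)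
    (hcost : ∫⁻ w, ENNReal.ofReal w ∂P ≤ ENNReal.ofReal (1 / lam - 1 / mu))
    (hI : I = ∫ x, Real.log (m.density ν x) ∂ν
      - ∫ x, Real.log (m.density (TimeModel.addLaw P ν) x) ∂TimeModel.addLaw P ν)
    (hI0 : 0 < I) :
    AchievableWithFeedback m ν lam (lam * (I / Real.log 2)) := by
  intro γ hγ
  set a : ℝ := 1 / lam - 1 / mu with ha_def
  have ha : 0 < a := sub_pos.mpr (one_div_lt_one_div_of_lt hlam hlt)
  have hlog : 0 < Real.log 2 := Real.log_pos (by norm_num)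
  have hint := TimeModel.integrable_of_lintegral_ofReal_le hP hcost
  have hPa : ∫ w, w ∂P ≤ a := by
    rw [integral_eq_lintegral_of_nonneg_ae (hP.mono fun _ h => h.2) hint.1]
    exact ENNReal.toReal_le_of_le_ofReal ha.le hcost
  obtain ⟨δ, hδrate, hδI, hδ⟩ : ∃ δ : ℝ, lam * (I / Real.log 2) - γ
      < lam * (a / (a + δ) * (I - 2 * δ) / Real.log 2) ∧ δ < I ∧ 0 < δ := by
    have hcont : ContinuousAt (fun δ : ℝ => lam * (a / (a + δ) * (I - 2 * δ) / Real.log 2)) 0 := by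
      have : a + 0 ≠ 0 := by linarith
      fun_prop (disch := assumption)
    have h1 : lam * (I / Real.log 2) - γ
        < lam * (a / (a + 0) * (I - 2 * 0) / Real.log 2) := by
      rw [add_zero, div_self ha.ne', mul_zero, sub_zero, one_mul]
      linarith
    have h2 := (hcont.eventually (lt_mem_nhds h1)).and (gt_mem_nhds hI0)
    obtain ⟨δ, h3, h4⟩ := ((h2.filter_mono nhdsWithin_le_nhds).and
      (self_mem_nhdsWithin (a := (0 : ℝ)) (s := Set.Ioi 0))).exists
    exact ⟨δ, h3.1, h3.2, h4⟩
  obtain ⟨ε, hε, hcode⟩ := TimeModel.exists_codebook hν hP hint hδ hδI hI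
    (by linarith : ∫ w, w ∂P < a + δ)
  have hθ : 0 < a / (a + δ) := by positivity
  let k : ℕ → ℕ := fun N => ⌊a / (a + δ) * N⌋₊
  have hk : Tendsto k atTop atTop := tendsto_nat_floor_atTop.comp
    (tendsto_natCast_atTop_atTop.const_mul_atTop hθ)
  have hkN : Tendsto (fun N : ℕ => (k N : ℝ) / N) atTop (𝓝 (a / (a + δ))) :=
    (tendsto_nat_floor_mul_div_atTop hθ.le).comp tendsto_natCast_atTop_atTop
  have hrate : Tendsto (fun N : ℕ => lam * ((k N : ℝ) / N * (I - 2 * δ) / Real.log 2)) atTop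
      (𝓝 (lam * (a / (a + δ) * (I - 2 * δ) / Real.log 2))) :=
    ((hkN.mul_const _).div_const _).const_mul _
  refine ⟨ε ∘ k, hε.comp hk, ?_⟩
  filter_upwards [hk.eventually hcode, hrate.eventually (lt_mem_nhds hδrate),
    eventually_gt_atTop 0] with N hN hN1 hN0
  obtain ⟨M, w, D, hM, hw, hsum, hD, hdis, hcongr, herr⟩ := hN
  have hN' : (0 : ℝ) < N := by exact_mod_cast hN0
  have hMpos : (0 : ℝ) < M := (Real.exp_pos _).trans_le hM
  have hkle : (k N : ℝ) ≤ a / (a + δ) * N := Nat.floor_le (by positivity)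
  have hkN' : k N ≤ N := by
    have h1 : a / (a + δ) ≤ 1 := (div_le_one (by positivity)).mpr (by linarith)
    have h2 : (k N : ℝ) ≤ N := hkle.trans (by nlinarith)
    exact_mod_cast h2
  obtain ⟨c, hc⟩ := exists_feedbackCode hν hkN' (by exact_mod_cast hMpos) hw hsum hD hdis hcongr
    herr
  refine ⟨M, c, ⟨hc.1.trans (ENNReal.ofReal_le_ofReal ?_), hc.2⟩, hN1.trans_le ?_⟩
  · have h1 : (k N : ℝ) * (a + δ) ≤ N * a := by
      calc (k N : ℝ) * (a + δ) ≤ a / (a + δ) * N * (a + δ) := by gcongr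
        _ = N * a := by field_simp
    rw [hmean]
    have h2 : (N : ℝ) / lam = N * a + N * (1 / mu) := by
      rw [ha_def]
      ring
    linarith
  · have h1 : (k N : ℝ) * (I - 2 * δ) ≤ Real.log M := (Real.le_log_iff_exp_le hMpos).mpr hM
    rw [Real.logb]
    calc lam * ((k N : ℝ) / N * (I - 2 * δ) / Real.log 2)
        = lam * ((k N : ℝ) * (I - 2 * δ) / Real.log 2 / N) := by ring
      _ ≤ lam * (Real.log M / Real.log 2 / N) := by gcongr

end Queue

end

theorem theorem3p4 (m : TimeModel) (ν : Measure ℝ) [IsProbabilityMeasure ν] (lam mu : ℝ)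
    (hlam : 0 < lam) (hlt : lam < mu)
    (hS : ∀ᵐ s ∂ν, s ∈ m.times)
    (hint : Integrable (fun s : ℝ => s) ν) (hmean : ∫ s, s ∂ν = 1 / mu)
    (hH : m.entropy ν ≠ ⊥)
    (h : m.maxEntropyDelayed ν (1 / lam - 1 / mu) < m.maxEntropy ν (1 / lam - 1 / mu)) :
    Queue.capacity m ν lam < Queue.feedbackCapacity m ν lam := by
  have hν := TimeModel.IsService.of_entropy_ne_bot hS hint hH
  have hlog : 0 < Real.log 2 := Real.log_pos (by norm_num)
  obtain ⟨P, hP⟩ := lt_iSup_iff.mp h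
  obtain ⟨⟨hPprob, hPt, hPcost⟩, hlt'⟩ := lt_iSup_iff.mp hP
  have hPint := TimeModel.integrable_of_lintegral_ofReal_le hPt hPcost
  have hself := TimeModel.entropy_le_maxEntropyDelayed_self (a := 1 / lam - 1 / mu) hS
  change _ < m.entropy (TimeModel.addLaw P ν) at hlt'
  have hpos := hself.trans_lt hlt'
  rw [hν.entropy, (hν.addLaw hPt hPint).entropy, EReal.coe_lt_coe_iff,
    div_lt_div_iff_of_pos_right hlog] at hpos
  obtain ⟨J, hJ1, hJ2⟩ := EReal.lt_iff_exists_real_btwn.mp hlt'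
  rw [(hν.addLaw hPt hPint).entropy, EReal.coe_lt_coe_iff] at hJ2
  have hach := Queue.achievableWithFeedback hν hlam hlt hmean hPt hPcost rfl (by linarith)
  refine (Queue.capacity_le hν hlam hlt hmean hJ1.le).trans_lt (lt_of_lt_of_le ?_
    (le_iSup₂ (f := fun (R : ℝ) (_ : Queue.AchievableWithFeedback m ν lam R) => (R : EReal))
      _ hach))
  rw [EReal.coe_lt_coe_iff]
  refine mul_lt_mul_of_pos_left ?_ hlam
  rw [sub_div]
  rw [neg_div] at hJ2
  linarith
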